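/- **Setting.** Let $t,s\in\mathbb C^n$ with $t_i\ne s_j$ for all $i,j$, let $\Phi\in\mathbb C^{n\times\alpha}$, $\Psi\in\mathbb C^{\alpha\times n}$, and let $R=\left[\frac{(\Phi\Psi)_{ij}}{t_i-s_j}\right]$ be the Cauchy-type matrix with $D_tR-RD_s=\Phi\Psi$. Factorize $R$ by the GKO-Cauchy algorithm with partial pivoting, in floating-point arithmetic in which every operation $\star\in\{+,-,\times,/\}$ returns $fl(a\star b)=(a\star b)(1+\delta)$ with $|\delta|\le\epsilon$. Number the rows (of $t$, $\Phi$, $R$) in the order produced by the row interchanges. With $\Phi^{(1)}=\Phi$, $\Psi^{(1)}=\Psi$, step $k=1,\dots,n$ of the algorithm computes (every operation rounded, inner products accumulated from left to right; $\varphi_i$ denotes row $i$ of $\Phi$ and $\psi_j$ column $j$ of $\Psi$) $$\tilde r^{(k)}_{ik}=\frac{\varphi^{(k)}_i\psi^{(k)}_k}{t_i-s_k}\ (i\ge k),\qquad \tilde u_{kk}=\tilde r_{kk}^{(k)},\qquad \tilde u_{kj}=\frac{\varphi^{(k)}_k\psi^{(k)}_j}{t_k-s_j}\ (j>k),\qquad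 \tilde l_{kk}=1,\qquad \tilde l_{ik}=\tilde r^{(k)}_{ik}/\tilde r^{(k)}_{kk}\ (i>k),$$ $$\psi^{(k+1)}_j=\psi^{(k)}_j-\psi^{(k)}_k\tilde u_{kj}/\tilde u_{kk}\ (j>k),\qquad \varphi^{(k+1)}_i=\varphi^{(k)}_i-\varphi^{(k)}_k\tilde l_{ik}\ (i>k),$$ where $|\tilde r^{(k)}_{kk}|=\max_{i\ge k}|\tilde r^{(k)}_{ik}|$ by pivoting, and it is assumed that $\tilde r_{kk}^{(k)}\neq0$ for $k<n$ (no breakdown). All other entries of $\tilde L=[\tilde l_{ik}]$ and $\tilde U=[\tilde u_{kj}]$ are $0$. The $\Phi^{(k)},\Psi^{(k)}$ are thus the *computed* generators. **Quantities.** Quantities without a tilde are obtained from the computed generators in exact arithmetic: $R_k$ has entries $r^{(k)}_{ij}=\varphi^{(k)}_i\psi^{(k)}_j/(t_i-s_j)$, $k\le i,j\le n$; $L$ is unit lower triangular with $l_{ik}=r^{(k)}_{ik}/r^{(k)}_{kk}$ $(i>k)$; $U$ is upper triangular with $u_{kj}=r^{(k)}_{kj}$ $(j\ge k)$. The matrix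 $V^{(k)}$, with entries $$v^{(k)}_{ij}=\frac{(|\Phi^{(k)}||\Psi^{(k)}|)_{ij}}{(\Phi^{(k)}\Psi^{(k)})_{ij}}\qquad(k\le i,j\le n),$$ where $|A|$ is the matrix of moduli, is assumed to be defined: the denominator vanishes only where the numerator does, and then $v^{(k)}_{ij}:=0$. Put $\hat L=[v^{(k)}_{ik}l_{ik}]_{i,k}$, $\hat U=[v^{(k)}_{kj}u_{kj}]_{k,j}$, $\hat R_k=V^{(k)}\circ R_k$ (elementwise product). All norms are Frobenius norms. Given constants $c_7,c_8,c_9$, the generator growth factors are $$g_1=c_7\frac{\|\hat L\|}{\|L\|}+c_8\frac{\|\hat U\|}{\|U\|}+c_9\bigl\|\mathrm{diag}\{v^{(k)}_{kk}\}\bigr\|,\qquad g_2=\max_{k=2,\dots,n}\frac{\|\hat R_k\|}{\|R_k\|}$$ (with $0/0:=0$, and $g_2:=0$ if $n\le1$). Let $b_{\max},b_{\min}$ be the maximum and minimum moduli of the entries of $B=[1/(t_i-s_j)]$. **Theorem.** For every $\alpha$ there are constants $c_0,c_5,c_6>0$ and $c_7,c_8,c_9\in(0,1)$, depending only on $\alpha$,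 such that for all $n,\epsilon,t,s,\Phi,\Psi$ and every run of the algorithm as above with $$\epsilon\,(g_1+n\,g_2)\le c_0,$$ the backward error $E=\tilde L\tilde U-R$ satisfies $$\|E\|\le\epsilon\left(c_5\frac{b_{\max}}{b_{\min}}\,g_1+c_6\,n\,g_2\right)\|L\|\,\|U\|.$$ -/

import Mathlib

attribute [local instance] Matrix.frobeniusNormedAddCommGroup

namespace GKO

noncomputable section

/-! ### Floating-point arithmetic -/

/-- `y` is a floating-point value of the exact result `x`: `y = x (1 + δ)` with `|δ| ≤ ε`. -/
def Rounds (ε : ℝ) (x y : ℂ) : Prop :=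
  ∃ δ : ℂ, ‖δ‖ ≤ ε ∧ y = x * (1 + δ)

/-- `z` is a floating-point value of the inner product `∑ a, x a * y a`: every product and every
addition is rounded, the sum being accumulated from left to right
(`q a` are the rounded products, `p a` the rounded partial sums). -/
def RoundedDot {α : ℕ} (ε : ℝ) (x y : Fin α → ℂ) (z : ℂ) : Prop :=
  ∃ (q : Fin α → ℂ) (p : Fin (α + 1) → ℂ),
    (∀ a, Rounds ε (x a * y a) (q a)) ∧
    p 0 = 0 ∧
    (∀ a : Fin α, Rounds ε (p a.castSucc + q a) (p a.succ)) ∧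
    p (Fin.last α) = z

/-- `z` is a floating-point value of `(∑ a, x a * y a) / (τ - σ)`. -/
def RoundedEntry {α : ℕ} (ε : ℝ) (x y : Fin α → ℂ) (τ σ z : ℂ) : Prop :=
  ∃ m d : ℂ, RoundedDot ε x y m ∧ Rounds ε (τ - σ) d ∧ Rounds ε (m / d) z

/-- `z` is a floating-point value of `a - b * c`. -/
def RoundedMulSub (ε : ℝ) (a b c z : ℂ) : Prop :=
  ∃ m : ℂ, Rounds ε (b * c) m ∧ Rounds ε (a - m) z

/-- `z` is a floating-point value of `a - b * c / d`. -/
def RoundedMulDivSub (ε : ℝ) (a b c d z : ℂ) : Prop :=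
  ∃ m w : ℂ, Rounds ε (b * c) m ∧ Rounds ε (m / d) w ∧ Rounds ε (a - w) z

/-! ### Cauchy-type matrices -/

/-- The Cauchy-type matrix with entries `φ_i ψ_j / (t_i - s_j)`; when `t_i ≠ s_j` for all `i, j`,
the unique solution of `D_t R - R D_s = Φ Ψ`. -/
def cauchyType {n α : ℕ} (t s : Fin n → ℂ)
    (Φ : Matrix (Fin n) (Fin α) ℂ) (Ψ : Matrix (Fin α) (Fin n) ℂ) : Matrix (Fin n) (Fin n) ℂ :=
  Matrix.of fun i j => (Φ * Ψ) i j / (t i - s j)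

/-- The ordinary Cauchy matrix `B = [1 / (t_i - s_j)]`. -/
def cauchy {n : ℕ} (t s : Fin n → ℂ) : Matrix (Fin n) (Fin n) ℂ :=
  Matrix.of fun i j => 1 / (t i - s j)

/-- Maximum modulus of the entries of a matrix. -/
def maxAbs {n : ℕ} (B : Matrix (Fin n) (Fin n) ℂ) : ℝ :=
  ⨆ p : Fin n × Fin n, ‖B p.1 p.2‖

/-- Minimum modulus of the entries of a matrix. -/
def minAbs {n : ℕ} (B : Matrix (Fin n) (Fin n) ℂ) : ℝ :=
  ⨅ p : Fin n × Fin n, ‖B p.1 p.2‖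

/-- The matrix `|A|` of moduli. -/
def absMat {m n : Type*} (A : Matrix m n ℂ) : Matrix m n ℂ :=
  A.map fun z => ((‖z‖ : ℝ) : ℂ)

/-! ### The GKO-Cauchy algorithm in floating-point arithmetic -/

/-- A run, with unit roundoff `ε`, of the GKO-Cauchy algorithm with partial pivoting on the input
`t, s, Φ, Ψ`.  Steps are numbered from `0`.  Row-indexed arrays are listed in the final row order:
the row in position `i` is row `perm i` of the input, so that the row interchanges are recorded
by `perm` together with the pivot condition. -/
structure Run {n α : ℕ} (ε : ℝ) (t s : Fin n → ℂ)
    (Φ : Matrix (Fin n) (Fin α) ℂ) (Ψ : Matrix (Fin α) (Fin n) ℂ) where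
  /-- the row order produced by the interchanges -/
  perm : Equiv.Perm (Fin n)
  /-- computed left generators at each step (row `i` is relevant at steps `k ≤ i`) -/
  genΦ : ℕ → Matrix (Fin n) (Fin α) ℂ
  /-- computed right generators at each step (column `j` is relevant at steps `k ≤ j`) -/
  genΨ : ℕ → Matrix (Fin α) (Fin n) ℂ
  /-- `col i k` is the computed entry in row `i ≥ k` of the first column of the `k`-th
  reduced matrix -/
  col : Matrix (Fin n) (Fin n) ℂ
  /-- computed lower triangular factor -/
  compL : Matrix (Fin n) (Fin n) ℂ
  /-- computed upper triangular factor -/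
  compU : Matrix (Fin n) (Fin n) ℂ
  genΦ_zero : genΦ 0 = Φ.submatrix perm id
  genΨ_zero : genΨ 0 = Ψ
  col_spec : ∀ k i : Fin n, k ≤ i →
    RoundedEntry ε (genΦ k i) (fun a => genΨ k a k) (t (perm i)) (s k) (col i k)
  /-- partial pivoting -/
  pivot_max : ∀ k i : Fin n, k ≤ i → ‖col i k‖ ≤ ‖col k k‖
  /-- no division by zero occurs -/
  pivot_ne_zero : ∀ k j : Fin n, k < j → col k k ≠ 0
  compU_diag : ∀ k : Fin n, compU k k = col k k
  compU_upper : ∀ k j : Fin n, k < j →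
    RoundedEntry ε (genΦ k k) (fun a => genΨ k a j) (t (perm k)) (s j) (compU k j)
  compU_lower : ∀ k j : Fin n, j < k → compU k j = 0
  compL_diag : ∀ k : Fin n, compL k k = 1
  compL_lower : ∀ k i : Fin n, k < i → Rounds ε (col i k / col k k) (compL i k)
  compL_upper : ∀ k i : Fin n, i < k → compL i k = 0
  genΨ_succ : ∀ k j : Fin n, k < j → ∀ a : Fin α,
    RoundedMulDivSub ε (genΨ k a j) (genΨ k a k) (compU k j) (compU k k) (genΨ (k + 1) a j)
  genΦ_succ : ∀ k i : Fin n, k < i → ∀ a : Fin α,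
    RoundedMulSub ε (genΦ k i a) (genΦ k k a) (compL i k) (genΦ (k + 1) i a)

namespace Run

variable {n α : ℕ} {ε : ℝ} {t s : Fin n → ℂ}
  {Φ : Matrix (Fin n) (Fin α) ℂ} {Ψ : Matrix (Fin α) (Fin n) ℂ}

/-- The backward error `E`: computed `L` times computed `U` minus the (row-permuted) input
matrix. -/
def backwardError (ρ : Run ε t s Φ Ψ) : Matrix (Fin n) (Fin n) ℂ :=
  ρ.compL * ρ.compU - (cauchyType t s Φ Ψ).submatrix ρ.perm id

/-- The reduced matrix `R_k` with the computed generators of step `k`, augmented by zero rows and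
columns to order `n`. -/
def reduced (ρ : Run ε t s Φ Ψ) (k : ℕ) : Matrix (Fin n) (Fin n) ℂ :=
  Matrix.of fun i j =>
    if k ≤ (i : ℕ) ∧ k ≤ (j : ℕ) then
      cauchyType (t ∘ ρ.perm) s (ρ.genΦ k) (ρ.genΨ k) i j
    else 0

/-- `L`: column `k` is obtained in exact arithmetic from the computed generators of step `k`. -/
def L (ρ : Run ε t s Φ Ψ) : Matrix (Fin n) (Fin n) ℂ :=
  Matrix.of fun i k =>
    if i = k then 1 else if k < i then ρ.reduced k i k / ρ.reduced k k k else 0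

/-- `U`: row `k` is obtained in exact arithmetic from the computed generators of step `k`. -/
def U (ρ : Run ε t s Φ Ψ) : Matrix (Fin n) (Fin n) ℂ :=
  Matrix.of fun k j => if k ≤ j then ρ.reduced k k j else 0

/-- `V_k = |Φ_k||Ψ_k| / (Φ_k Ψ_k)`, elementwise. -/
def V (ρ : Run ε t s Φ Ψ) (k : ℕ) : Matrix (Fin n) (Fin n) ℂ :=
  Matrix.of fun i j =>
    (absMat (ρ.genΦ k) * absMat (ρ.genΨ k)) i j / (ρ.genΦ k * ρ.genΨ k) i j

/-- The equation `|Φ_k||Ψ_k| = V_k ∘ Φ_k Ψ_k` can be solved for `V_k` at every step `k`, on the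
rows and columns that are present at step `k`. -/
def VDefined (ρ : Run ε t s Φ Ψ) : Prop :=
  ∀ k i j : Fin n, k ≤ i → k ≤ j → (ρ.genΦ k * ρ.genΨ k) i j = 0 →
    (absMat (ρ.genΦ k) * absMat (ρ.genΨ k)) i j = 0

/-- Column `k` of `L` multiplied elementwise by column `k` of `V_k`. -/
def Lhat (ρ : Run ε t s Φ Ψ) : Matrix (Fin n) (Fin n) ℂ :=
  Matrix.of fun i k => ρ.V k i k * ρ.L i k

/-- Row `k` of `U` multiplied elementwise by row `k` of `V_k`. -/
def Uhat (ρ : Run ε t s Φ Ψ) : Matrix (Fin n) (Fin n) ℂ :=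
  Matrix.of fun k j => ρ.V k k j * ρ.U k j

/-- `V_k ∘ R_k`. -/
def Rhat (ρ : Run ε t s Φ Ψ) (k : ℕ) : Matrix (Fin n) (Fin n) ℂ :=
  Matrix.hadamard (ρ.V k) (ρ.reduced k)

/-- The generator growth factor `g₁` (Frobenius norms). -/
def g₁ (ρ : Run ε t s Φ Ψ) (c₇ c₈ c₉ : ℝ) : ℝ :=
  c₇ * (‖ρ.Lhat‖ / ‖ρ.L‖) + c₈ * (‖ρ.Uhat‖ / ‖ρ.U‖) +
    c₉ * ‖(Matrix.diagonal fun k : Fin n => ρ.V k k k : Matrix (Fin n) (Fin n) ℂ)‖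

/-- The generator growth factor `g₂`: maximum over all steps but the first (`0` if there is no
other step). -/
def g₂ (ρ : Run ε t s Φ Ψ) : ℝ :=
  ⨆ k : {k : Fin n // 0 < (k : ℕ)}, ‖ρ.Rhat k.1‖ / ‖ρ.reduced k.1‖

end Run

end

end GKO

/-!
The computed factors are compared with the matrices `L` and `U` that exact arithmetic would give
from the computed generators, and the computed generators of step `k + 1` are compared with an
exact elimination step applied to those of step `k`.

A rounded entry `φ_i ψ_j / (t_i - s_j)` has an error of at most a multiple of
`ε |v_ij| |r_ij|` (`Run.roundedEntry_sub_reduced_le`), since the rounding errors of an inner product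
are relative to the sum of the moduli of its terms.  Hence `Ũ - U` is entrywise of the order
`ε |Û|`, and `L̃ - L` is of the order `ε (|L̂| + |L| diag |v_kk|)`; the division by the computed
pivot is harmless because `ε |v_kk|` is at most a multiple of `ε g₁`, which is small.

The Schur complement of `R_k` is the Cauchy-type matrix of the generators
`φ_i - φ_k l_ik`, `ψ_j - ψ_k u_kj / u_kk`.  Replacing `l_ik` and `u_kj / u_kk` by their computed
values, and rounding the updates, changes it by `stepError k`, which has two parts
(`Run.norm_stepError_le`): a multiple of `ε |R̂_{k+1}|`, which is the rounding error relative to the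
new generators, and `ε b_max / b_min` times products of one entry of column `k` of `L` and one of
row `k` of `U`, one of them weighted by `V`.  The quotient `b_max / b_min` arises because the
numerators belong to the positions `(i, k)`, `(k, j)`, `(k, k)` and the denominator to `(i, j)`.

Summing `R_k - R_{k+1} = l_k u_k + stepError k` over the steps expresses `R` as `L U` plus the step
errors.  The products with one weight sum to matrix products, so submultiplicativity of the
Frobenius norm bounds them by a multiple of `g₁ ‖L‖ ‖U‖` (`Run.norm_errLU_le`); the other part is
at most `6 ε n g₂ max_k ‖R_k‖`.  The same sum started at step `k` bounds `‖R_k‖` by `‖L‖ ‖U‖`, the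
errors of the first kind, and `6 ε n g₂ max_k ‖R_k‖ ≤ (1 / 2) max_k ‖R_k‖`, so that the maximum is
controlled without any bound on `ε b_max / b_min`.

The smallness of `ε` itself comes from the first pivot: if `V` does not vanish there, its modulus is
at least one, so that `ε` is at most `2 ε g₁`.  It can vanish only for `n ≤ 1`, and then there is no
error at all.
-/

namespace GKO

/-! ### Rounding errors of single operations and of inner products -/

theorem Rounds.sub_norm_le {ε : ℝ} {x y : ℂ} (h : Rounds ε x y) : ‖y - x‖ ≤ ε * ‖x‖ := by
  obtain ⟨δ, hδ, rfl⟩ := h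
  rw [show x * (1 + δ) - x = δ * x by ring, norm_mul]
  gcongr

theorem RoundedDot.sub_norm_le {α : ℕ} {ε : ℝ} (hε : 0 ≤ ε) {x y : Fin α → ℂ} {z : ℂ}
    (h : RoundedDot ε x y z) :
    ‖z - ∑ a, x a * y a‖ ≤ ((1 + ε) ^ (α + 1) - 1) * ∑ a, ‖x a‖ * ‖y a‖ := by
  induction α generalizing z with
  | zero =>
    obtain ⟨q, p, -, h0, -, rfl⟩ := h
    simp [h0]
  | succ α ih =>
    obtain ⟨q, p, hq, h0, hp, rfl⟩ := h
    have hprev := ih (x := fun a => x a.castSucc) (y := fun a => y a.castSucc)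
      ⟨fun a => q a.castSucc, fun a => p a.castSucc, fun a => hq a.castSucc, h0,
        fun a => by simpa only [Fin.succ_castSucc] using hp a.castSucc, rfl⟩
    have hQ := (hq (Fin.last α)).sub_norm_le
    obtain ⟨δ, hδ, hlast⟩ := hp (Fin.last α)
    rw [Fin.succ_last] at hlast
    rw [hlast, Fin.sum_univ_castSucc, Fin.sum_univ_castSucc]
    have hST : ‖∑ a : Fin α, x a.castSucc * y a.castSucc‖ ≤
        ∑ a : Fin α, ‖x a.castSucc‖ * ‖y a.castSucc‖ :=
      (norm_sum_le _ _).trans_eq (by simp)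
    set S := ∑ a : Fin α, x a.castSucc * y a.castSucc
    set T := ∑ a : Fin α, ‖x a.castSucc‖ * ‖y a.castSucc‖
    set P := p (Fin.last α).castSucc
    set Q := q (Fin.last α)
    rw [← norm_mul]
    set w := x (Fin.last α) * y (Fin.last α)
    have hE : 1 + ε ≤ (1 + ε) ^ (α + 1) := le_self_pow₀ (by linarith) (by omega)
    set F := (1 + ε) ^ (α + 1) with hF
    have h1 : ‖1 + δ‖ ≤ 1 + ε := (norm_add_le _ _).trans (by simpa using hδ)
    calc ‖(P + Q) * (1 + δ) - (S + w)‖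
        = ‖(P - S) * (1 + δ) + (Q - w) * (1 + δ) + (S + w) * δ‖ := by ring_nf
      _ ≤ ‖P - S‖ * ‖1 + δ‖ + ‖Q - w‖ * ‖1 + δ‖ + ‖S + w‖ * ‖δ‖ := by
          refine (norm_add₃_le).trans_eq (by simp only [norm_mul])
      _ ≤ ((F - 1) * T) * (1 + ε) + (ε * ‖w‖) * (1 + ε) + (T + ‖w‖) * ε := by
          have : ‖S + w‖ ≤ T + ‖w‖ := (norm_add_le _ _).trans (by linarith)
          have := (norm_nonneg _).trans hprev
          gcongr
      _ = (F * (1 + ε) - 1) * T + ((1 + ε) * (1 + ε) - 1) * ‖w‖ := by ring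
      _ ≤ (F * (1 + ε) - 1) * T + (F * (1 + ε) - 1) * ‖w‖ := by gcongr
      _ = ((1 + ε) ^ (α + 1 + 1) - 1) * (T + ‖w‖) := by rw [pow_succ, ← hF]; ring

/-- Convexity of `ε ↦ (1 + ε) ^ m` on `[0, 1]`. -/
theorem one_add_pow_sub_one_le {ε : ℝ} (h0 : 0 ≤ ε) (h1 : ε ≤ 1) (m : ℕ) :
    (1 + ε) ^ m - 1 ≤ 2 ^ m * ε := by
  suffices h : (1 + ε) ^ m - 1 ≤ (2 ^ m - 1) * ε by linarith
  induction m with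
  | zero => simp
  | succ m ih =>
    have h2 : (1 : ℝ) ≤ 2 ^ m := one_le_pow₀ (by norm_num)
    rw [pow_succ, pow_succ]
    nlinarith [mul_nonneg (sub_nonneg.2 ih) h0,
      mul_nonneg (mul_nonneg (sub_nonneg.2 h1) h0) (sub_nonneg.2 h2)]

/-- The constant in the error bound for a computed entry `φ_i ψ_j / (t_i - s_j)`. -/
noncomputable def entryConst (α : ℕ) : ℝ := 3 * 2 ^ (α + 1) + 4

theorem ten_le_entryConst (α : ℕ) : 10 ≤ entryConst α := by
  have : (1 : ℝ) ≤ 2 ^ α := one_le_pow₀ (by norm_num)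
  rw [entryConst, pow_succ]; linarith

/-- Vanishing products make the computed entry exact, whatever the size of `ε`. -/
theorem RoundedEntry.eq_zero {α : ℕ} {ε : ℝ} (hε : 0 ≤ ε) {x y : Fin α → ℂ} {τ σ z : ℂ}
    (h : RoundedEntry ε x y τ σ z) (h0 : ∑ a, ‖x a‖ * ‖y a‖ = 0) : z = 0 := by
  obtain ⟨m, d, hm, -, δ, -, rfl⟩ := h
  have h1 := hm.sub_norm_le hε
  have h2 : ∑ a, x a * y a = 0 := by
    rw [← norm_le_zero_iff, ← h0]
    exact (norm_sum_le _ _).trans_eq (by simp)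
  rw [h0, h2, mul_zero, sub_zero, norm_le_zero_iff] at h1
  simp [h1]

theorem norm_one_add_ge {ε : ℝ} {δ : ℂ} (hδ : ‖δ‖ ≤ ε) (h1 : ε ≤ 1 / 2) : 1 / 2 ≤ ‖1 + δ‖ := by
  have := norm_sub_le_norm_add (1 : ℂ) δ
  rw [norm_one] at this
  linarith

theorem RoundedEntry.sub_norm_le {α : ℕ} {ε : ℝ} (hε : 0 ≤ ε) (hε' : ε ≤ 1 / 2)
    {x y : Fin α → ℂ} {τ σ z : ℂ} (h : RoundedEntry ε x y τ σ z) :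
    ‖z - (∑ a, x a * y a) / (τ - σ)‖ ≤
      entryConst α * ε * ((∑ a, ‖x a‖ * ‖y a‖) / ‖τ - σ‖) := by
  obtain ⟨m, d, hm, ⟨δ, hδ, rfl⟩, δ', hδ', rfl⟩ := h
  have h1 := hm.sub_norm_le hε
  have hc := one_add_pow_sub_one_le hε (by linarith) (α + 1)
  have hST : ‖∑ a, x a * y a‖ ≤ ∑ a, ‖x a‖ * ‖y a‖ := (norm_sum_le _ _).trans_eq (by simp)
  set S := ∑ a, x a * y a
  set T := ∑ a, ‖x a‖ * ‖y a‖
  have hT : 0 ≤ T := (norm_nonneg _).trans hST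
  have h2 : ‖m - S‖ ≤ 2 ^ (α + 1) * ε * T := h1.trans (by gcongr)
  have hd := norm_one_add_ge hδ hε'
  have hne : (1 + δ) ≠ 0 := norm_pos_iff.1 (by linarith)
  have hq : ‖(1 + δ') / (1 + δ) - 1‖ ≤ 4 * ε := by
    rw [show (1 + δ') / (1 + δ) - 1 = (δ' - δ) / (1 + δ) by field_simp; ring, norm_div,
      div_le_iff₀ (by linarith)]
    have := norm_sub_le δ' δ
    nlinarith
  set ρ := (1 + δ') / (1 + δ) with hρ
  have key : ‖m * ρ - S‖ ≤ entryConst α * ε * T := by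
    calc ‖m * ρ - S‖ = ‖(m - S) * (1 + (ρ - 1)) + S * (ρ - 1)‖ := by ring_nf
      _ ≤ ‖m - S‖ * (1 + ‖ρ - 1‖) + ‖S‖ * ‖ρ - 1‖ := by
          refine (norm_add_le _ _).trans ?_
          rw [norm_mul, norm_mul]
          gcongr
          exact (norm_add_le _ _).trans_eq (by simp)
      _ ≤ (2 ^ (α + 1) * ε * T) * (1 + 2) + T * (4 * ε) := by
          gcongr
          linarith
      _ = entryConst α * ε * T := by rw [entryConst]; ring
  rw [show m / ((τ - σ) * (1 + δ)) * (1 + δ') - S / (τ - σ) = (m * ρ - S) / (τ - σ) by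
    rw [hρ]; by_cases h : τ - σ = 0
    · simp [h]
    · field_simp, norm_div]
  exact (div_le_div_of_nonneg_right key (norm_nonneg _)).trans_eq (mul_div_assoc _ _ _)

/-- Effect of the rounding errors in one generator update on a single term of the next inner
product.  The error relative to the updated generators is kept apart: it is the part that is
later measured by `g₂`. -/
theorem norm_mul_sub_mul_le_of_rounded {ε : ℝ} (hε : 0 ≤ ε) (hε' : ε ≤ 1 / 2)
    {φ p l φ' ψ q u d ψ' : ℂ} (h₁ : RoundedMulSub ε φ p l φ')
    (h₂ : RoundedMulDivSub ε ψ q u d ψ') :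
    ‖(φ - p * l) * (ψ - q * (u / d)) - φ' * ψ'‖ ≤ 6 * ε * (‖φ'‖ * ‖ψ'‖) +
      28 * ε * (‖p‖ * ‖ψ‖ * ‖l‖ + ‖p‖ * ‖q‖ * (‖l‖ * ‖u / d‖) + ‖φ‖ * ‖q‖ * ‖u / d‖) := by
  obtain ⟨_, ⟨δ₁, hδ₁, rfl⟩, δ₂, hδ₂, hφ⟩ := h₁
  obtain ⟨_, _, ⟨δ₃, hδ₃, rfl⟩, ⟨δ₄, hδ₄, rfl⟩, δ₅, hδ₅, hψ⟩ := h₂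
  set m := u / d with hm
  -- the two roundings of the quotient combine to a single one of relative size `3 ε`
  obtain ⟨δ, hδ, hw⟩ : ∃ δ : ℂ, ‖δ‖ ≤ 3 * ε ∧
      q * u * (1 + δ₃) / d * (1 + δ₄) = q * m * (1 + δ) := by
    refine ⟨δ₃ + δ₄ + δ₃ * δ₄, ?_, by rw [hm]; ring⟩
    refine norm_add₃_le.trans ?_
    rw [norm_mul]
    have : ‖δ₃‖ * ‖δ₄‖ ≤ ε * 1 := by
      gcongr
      linarith
    linarith
  rw [hw] at hψ
  have hA : ‖φ - p * l - φ'‖ ≤ 2 * ε * ‖φ'‖ + ε * (‖p‖ * ‖l‖) := by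
    have hne : (1 + δ₂) ≠ 0 := norm_pos_iff.1 (by linarith [norm_one_add_ge hδ₂ hε'])
    have : φ - p * l - φ' = -(δ₂ / (1 + δ₂) * φ') + δ₁ * (p * l) := by
      rw [hφ]; field_simp; ring
    rw [this]
    refine (norm_add_le _ _).trans ?_
    rw [norm_neg, norm_mul, norm_mul, norm_mul p, norm_div]
    gcongr
    rw [div_le_iff₀ (norm_pos_iff.2 hne)]
    nlinarith [norm_one_add_ge hδ₂ hε']
  have hB : ‖ψ - q * m - ψ'‖ ≤ 2 * ε * ‖ψ'‖ + 3 * ε * (‖q‖ * ‖m‖) := by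
    have hne : (1 + δ₅) ≠ 0 := norm_pos_iff.1 (by linarith [norm_one_add_ge hδ₅ hε'])
    have : ψ - q * m - ψ' = -(δ₅ / (1 + δ₅) * ψ') + δ * (q * m) := by
      rw [hψ]; field_simp; ring
    rw [this]
    refine (norm_add_le _ _).trans ?_
    rw [norm_neg, norm_mul, norm_mul, norm_mul q, norm_div]
    gcongr
    rw [div_le_iff₀ (norm_pos_iff.2 hne)]
    nlinarith [norm_one_add_ge hδ₅ hε']
  have hone : ∀ {δ : ℂ} {c : ℝ}, ‖δ‖ ≤ c → ‖1 + δ‖ ≤ 1 + c := fun h =>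
    (norm_add_le _ _).trans (by simpa using h)
  have hφ' : ‖φ'‖ ≤ 2 * ‖φ‖ + 3 * (‖p‖ * ‖l‖) := by
    rw [hφ, norm_mul]
    have h1 : ‖φ - p * l * (1 + δ₁)‖ ≤ ‖φ‖ + ‖p‖ * ‖l‖ * (3 / 2) := by
      refine (norm_sub_le _ _).trans ?_
      rw [norm_mul, norm_mul]
      gcongr
      linarith [hone hδ₁]
    calc _ ≤ (‖φ‖ + ‖p‖ * ‖l‖ * (3 / 2)) * (3 / 2) := by
          gcongr
          linarith [hone hδ₂]
      _ ≤ _ := by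
          have := norm_nonneg φ
          have : 0 ≤ ‖p‖ * ‖l‖ := by positivity
          linarith
  have hψ' : ‖ψ'‖ ≤ 2 * ‖ψ‖ + 4 * (‖q‖ * ‖m‖) := by
    rw [hψ, norm_mul]
    have h1 : ‖ψ - q * m * (1 + δ)‖ ≤ ‖ψ‖ + ‖q‖ * ‖m‖ * (5 / 2) := by
      refine (norm_sub_le _ _).trans ?_
      rw [norm_mul, norm_mul]
      gcongr
      linarith [hone hδ]
    calc _ ≤ (‖ψ‖ + ‖q‖ * ‖m‖ * (5 / 2)) * (3 / 2) := by
          gcongr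
          linarith [hone hδ₅]
      _ ≤ _ := by
          have := norm_nonneg ψ
          have : 0 ≤ ‖q‖ * ‖m‖ := by positivity
          linarith
  have hsplit : ‖(φ - p * l) * (ψ - q * m) - φ' * ψ'‖ ≤
      ‖φ - p * l - φ'‖ * ‖ψ'‖ + ‖φ - p * l - φ'‖ * ‖ψ - q * m - ψ'‖ +
        ‖φ'‖ * ‖ψ - q * m - ψ'‖ := by
    rw [show (φ - p * l) * (ψ - q * m) - φ' * ψ' = (φ - p * l - φ') * ψ' +
      (φ - p * l - φ') * (ψ - q * m - ψ') + φ' * (ψ - q * m - ψ') by ring]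
    exact norm_add₃_le.trans_eq (by simp only [norm_mul])
  refine hsplit.trans ?_
  have hb := norm_nonneg (ψ - q * m - ψ')
  generalize ‖φ - p * l - φ'‖ = a at *
  generalize ‖ψ - q * m - ψ'‖ = b at *
  have hφ0 := norm_nonneg φ
  have hψ0 := norm_nonneg ψ
  have hφ'0 := norm_nonneg φ'
  have hψ'0 := norm_nonneg ψ'
  have hpl : 0 ≤ ‖p‖ * ‖l‖ := by positivity
  have hqm : 0 ≤ ‖q‖ * ‖m‖ := by positivity
  rw [show ‖p‖ * ‖ψ‖ * ‖l‖ = (‖p‖ * ‖l‖) * ‖ψ‖ by ring,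
    show ‖p‖ * ‖q‖ * (‖l‖ * ‖m‖) = (‖p‖ * ‖l‖) * (‖q‖ * ‖m‖) by ring,
    show ‖φ‖ * ‖q‖ * ‖m‖ = ‖φ‖ * (‖q‖ * ‖m‖) by ring]
  generalize ‖p‖ * ‖l‖ = P at *
  generalize ‖q‖ * ‖m‖ = Q at *
  generalize ‖φ‖ = x at *
  generalize ‖ψ‖ = y at *
  generalize ‖φ'‖ = x' at *
  generalize ‖ψ'‖ = y' at *
  calc a * y' + a * b + x' * b
      ≤ (2 * ε * x' + ε * P) * y' + (2 * ε * x' + ε * P) * (2 * ε * y' + 3 * ε * Q) +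
          x' * (2 * ε * y' + 3 * ε * Q) := by gcongr
    _ = ε * ((4 + 4 * ε) * (x' * y') + (1 + 2 * ε) * (P * y') + (3 + 6 * ε) * (x' * Q) +
          3 * ε * (P * Q)) := by ring
    _ ≤ ε * (6 * (x' * y') + 2 * (P * y') + 6 * (x' * Q) + 2 * (P * Q)) := by
        gcongr <;> linarith
    _ ≤ ε * (6 * (x' * y') + 2 * (P * (2 * y + 4 * Q)) + 6 * ((2 * x + 3 * P) * Q) +
          2 * (P * Q)) := by gcongr
    _ ≤ 6 * ε * (x' * y') + 28 * ε * (P * y + P * Q + x * Q) := by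
        have h1 : 0 ≤ ε * (P * y) := by positivity
        have h2 : 0 ≤ ε * (x * Q) := by positivity
        nlinarith

/-- Error of a quotient whose numerator and denominator carry the errors `c x̂` and
`c w |y| ≤ |y| / 2`. -/
theorem norm_div_sub_div_mul_le {x y x' y' : ℂ} {c xh w : ℝ} (hy : y ≠ 0)
    (hx' : ‖x' - x‖ ≤ c * xh) (hy' : ‖y' - y‖ ≤ c * (w * ‖y‖)) (hc : c * w ≤ 1 / 2) :
    ‖x' / y' - x / y‖ * ‖y‖ ≤ 2 * c * (xh + w * ‖x‖) := by
  have hy0 : 0 < ‖y‖ := norm_pos_iff.2 hy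
  have hh : ‖y‖ ≤ 2 * ‖y'‖ := by
    have := norm_sub_norm_le y y'
    rw [norm_sub_rev] at this
    nlinarith
  have hy'0 : 0 < ‖y'‖ := by linarith
  have hne : y' ≠ 0 := norm_pos_iff.1 hy'0
  rw [← norm_mul, show (x' / y' - x / y) * y = ((x' - x) * y - x * (y' - y)) / y' by
    field_simp; ring, norm_div, div_le_iff₀ hy'0]
  refine (norm_sub_le _ _).trans ?_
  rw [norm_mul, norm_mul]
  calc ‖x' - x‖ * ‖y‖ + ‖x‖ * ‖y' - y‖ ≤ c * xh * ‖y‖ + ‖x‖ * (c * (w * ‖y‖)) := by gcongr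
    _ = c * (xh + w * ‖x‖) * ‖y‖ := by ring
    _ ≤ c * (xh + w * ‖x‖) * (2 * ‖y'‖) := by
        have h1 : 0 ≤ c * xh := (norm_nonneg _).trans hx'
        have h2 : 0 ≤ c * w := by
          have := (norm_nonneg _).trans hy'
          rw [← mul_assoc] at this
          exact nonneg_of_mul_nonneg_left this hy0
        have : 0 ≤ c * (xh + w * ‖x‖) := by nlinarith [mul_nonneg h2 (norm_nonneg x)]
        gcongr
    _ = 2 * c * (xh + w * ‖x‖) * ‖y'‖ := by ring

/-! ### Frobenius norms and entrywise bounds -/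

theorem frobenius_norm_le_of_entry_le {m n 𝕜 𝕜' : Type*} [Fintype m] [Fintype n]
    [NormedAddCommGroup 𝕜] [NormedAddCommGroup 𝕜']
    {A : Matrix m n 𝕜} {B : Matrix m n 𝕜'} (h : ∀ i j, ‖A i j‖ ≤ ‖B i j‖) : ‖A‖ ≤ ‖B‖ := by
  rw [Matrix.frobenius_norm_def, Matrix.frobenius_norm_def]
  gcongr
  exact h _ _

theorem frobenius_norm_map_norm {m n : Type*} [Fintype m] [Fintype n] (A : Matrix m n ℂ) :
    ‖A.map (‖·‖)‖ = ‖A‖ :=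
  le_antisymm (frobenius_norm_le_of_entry_le fun i j => by simp)
    (frobenius_norm_le_of_entry_le fun i j => by simp)

theorem norm_entry_le_frobenius_norm {m n : Type*} [Fintype m] [Fintype n] (A : Matrix m n ℂ)
    (i : m) (j : n) : ‖A i j‖ ≤ ‖A‖ := by
  classical
  calc ‖A i j‖ = ‖(Matrix.single i j (A i j) : Matrix m n ℂ)‖ := by
        rw [Matrix.frobenius_norm_def, Finset.sum_eq_single i, Finset.sum_eq_single j]
        · simp [-one_div, ← Real.sqrt_eq_rpow]
        · intro b _ hb; simp [Matrix.single, hb.symm]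
        · simp
        · intro b _ hb; simp [Matrix.single, hb.symm]
        · simp
    _ ≤ ‖A‖ := frobenius_norm_le_of_entry_le fun a b => by
        by_cases h : i = a ∧ j = b
        · obtain ⟨rfl, rfl⟩ := h; simp
        · simp [Matrix.single, h]

theorem frobenius_norm_smul {m n : Type*} [Fintype m] [Fintype n] (c : ℝ) (A : Matrix m n ℝ) :
    ‖c • A‖ = ‖c‖ * ‖A‖ := by
  let _ : NormedSpace ℝ (Matrix m n ℝ) := Matrix.frobeniusNormedSpace
  exact norm_smul c A

/-! ### Entrywise errors of the computed factors -/

namespace Run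

variable {n α : ℕ} {ε : ℝ} {t s : Fin n → ℂ}
  {Φ : Matrix (Fin n) (Fin α) ℂ} {Ψ : Matrix (Fin α) (Fin n) ℂ}

/-- The defining equation of `V` with the denominator cleared.  Where the denominator vanishes,
`V` is `0` by division by zero, and `VDefined` makes the left-hand side vanish as well. -/
theorem sum_norm_mul_norm_eq {ρ : Run ε t s Φ Ψ} (hV : ρ.VDefined) {k i j : Fin n}
    (hi : k ≤ i) (hj : k ≤ j) :
    ∑ a, ‖ρ.genΦ k i a‖ * ‖ρ.genΨ k a j‖ = ‖ρ.V k i j‖ * ‖(ρ.genΦ k * ρ.genΨ k) i j‖ := by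
  have habs : (absMat (ρ.genΦ k) * absMat (ρ.genΨ k)) i j =
      ((∑ a, ‖ρ.genΦ k i a‖ * ‖ρ.genΨ k a j‖ : ℝ) : ℂ) := by
    simp [absMat, Matrix.mul_apply]
  have hnn : 0 ≤ ∑ a, ‖ρ.genΦ k i a‖ * ‖ρ.genΨ k a j‖ := by positivity
  by_cases h0 : (ρ.genΦ k * ρ.genΨ k) i j = 0
  · have := hV k i j hi hj h0
    rw [habs] at this
    rw [h0, norm_zero, mul_zero]
    exact_mod_cast this
  · rw [V, Matrix.of_apply, norm_div, div_mul_cancel₀ _ (norm_ne_zero_iff.2 h0), habs,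
      Complex.norm_of_nonneg hnn]

theorem reduced_apply (ρ : Run ε t s Φ Ψ) {k : ℕ} {i j : Fin n} (hi : k ≤ i) (hj : k ≤ j) :
    ρ.reduced k i j = (ρ.genΦ k * ρ.genΨ k) i j / (t (ρ.perm i) - s j) := by
  simp [reduced, cauchyType, hi, hj]

theorem reduced_eq_zero (ρ : Run ε t s Φ Ψ) {k : ℕ} {i j : Fin n}
    (h : (i : ℕ) < k ∨ (j : ℕ) < k) : ρ.reduced k i j = 0 := by
  simp only [reduced, Matrix.of_apply]
  exact if_neg (by omega)

theorem mul_apply_eq_reduced_mul (ρ : Run ε t s Φ Ψ) (hts : ∀ i j, t i ≠ s j) {k : ℕ}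
    {i j : Fin n} (hi : k ≤ i) (hj : k ≤ j) :
    (ρ.genΦ k * ρ.genΨ k) i j = ρ.reduced k i j * (t (ρ.perm i) - s j) := by
  rw [reduced_apply ρ hi hj, div_mul_cancel₀ _ (sub_ne_zero.2 (hts _ _))]

theorem L_apply_self (ρ : Run ε t s Φ Ψ) (k : Fin n) : ρ.L k k = 1 := by simp [L]

theorem L_apply_of_lt (ρ : Run ε t s Φ Ψ) {k i : Fin n} (h : k < i) :
    ρ.L i k = ρ.reduced k i k / ρ.reduced k k k := by simp [L, h, h.ne']

theorem L_apply_of_gt (ρ : Run ε t s Φ Ψ) {k i : Fin n} (h : i < k) : ρ.L i k = 0 := by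
  simp [L, h.ne, h.le.not_gt]

theorem U_apply_of_le (ρ : Run ε t s Φ Ψ) {k j : Fin n} (h : k ≤ j) :
    ρ.U k j = ρ.reduced k k j := by simp [U, h]

theorem U_apply_of_gt (ρ : Run ε t s Φ Ψ) {k j : Fin n} (h : j < k) : ρ.U k j = 0 := by
  simp [U, h.not_ge]

/-- The rounding error of a computed entry of the reduced matrix is governed by `V`. -/
theorem roundedEntry_sub_reduced_le {ρ : Run ε t s Φ Ψ} (hε : 0 ≤ ε) (hε' : ε ≤ 1 / 2)
    (hV : ρ.VDefined) {k i j : Fin n} (hi : k ≤ i) (hj : k ≤ j) {z : ℂ}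
    (hz : RoundedEntry ε (ρ.genΦ k i) (fun a => ρ.genΨ k a j) (t (ρ.perm i)) (s j) z) :
    ‖z - ρ.reduced k i j‖ ≤ entryConst α * ε * (‖ρ.V k i j‖ * ‖ρ.reduced k i j‖) := by
  have h := hz.sub_norm_le hε hε'
  rwa [sum_norm_mul_norm_eq hV hi hj, ← Matrix.mul_apply, mul_div_assoc, ← norm_div,
    ← reduced_apply ρ (by exact_mod_cast hi) (by exact_mod_cast hj)] at h

theorem norm_compU_sub_U_le {ρ : Run ε t s Φ Ψ} (hε : 0 ≤ ε) (hε' : ε ≤ 1 / 2)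
    (hV : ρ.VDefined) (k j : Fin n) :
    ‖ρ.compU k j - ρ.U k j‖ ≤ entryConst α * ε * ‖ρ.Uhat k j‖ := by
  rw [Uhat, Matrix.of_apply, norm_mul]
  rcases lt_trichotomy k j with h | rfl | h
  · rw [U_apply_of_le ρ h.le]
    exact roundedEntry_sub_reduced_le hε hε' hV le_rfl h.le (ρ.compU_upper k j h)
  · rw [U_apply_of_le ρ le_rfl, ρ.compU_diag]
    exact roundedEntry_sub_reduced_le hε hε' hV le_rfl le_rfl (ρ.col_spec k k le_rfl)
  · simp [U_apply_of_gt ρ h, ρ.compU_lower k j h]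

theorem reduced_pivot_ne_zero {ρ : Run ε t s Φ Ψ} (hε : 0 ≤ ε) (hε' : ε ≤ 1 / 2)
    (hV : ρ.VDefined) {k j : Fin n} (h : k < j) : ρ.reduced k k k ≠ 0 := by
  intro h0
  have := roundedEntry_sub_reduced_le hε hε' hV le_rfl le_rfl (ρ.col_spec k k le_rfl)
  rw [h0, norm_zero, mul_zero, mul_zero, sub_zero, norm_le_zero_iff] at this
  exact ρ.pivot_ne_zero k j h this

/-- If `V` vanishes at a pivot position, the pivot is computed exactly, and it is zero. -/
theorem col_eq_zero_of_V_eq_zero {ρ : Run ε t s Φ Ψ} (hε : 0 ≤ ε) (hV : ρ.VDefined) {k : Fin n}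
    (h : ρ.V k k k = 0) : ρ.col k k = 0 :=
  (ρ.col_spec k k le_rfl).eq_zero hε (by
    rw [sum_norm_mul_norm_eq hV le_rfl le_rfl, h, norm_zero, zero_mul])

theorem one_le_norm_V {ρ : Run ε t s Φ Ψ} (hV : ρ.VDefined) {k : Fin n} (h : ρ.V k k k ≠ 0) :
    1 ≤ ‖ρ.V k k k‖ := by
  have h0 : (ρ.genΦ k * ρ.genΨ k) k k ≠ 0 := fun h0 => h (by simp [V, h0])
  have h1 := sum_norm_mul_norm_eq hV (le_refl k) (le_refl k)
  have h2 : ‖(ρ.genΦ k * ρ.genΨ k) k k‖ ≤ ∑ a, ‖ρ.genΦ k k a‖ * ‖ρ.genΨ k a k‖ := by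
    rw [Matrix.mul_apply]
    exact (norm_sum_le _ _).trans_eq (by simp)
  rw [h1] at h2
  exact le_of_mul_le_mul_right (by linarith) (norm_pos_iff.2 h0)

/-- Entrywise measure of the error of the computed `L`, up to a multiple of `ε`: the first term
comes from the numerators `r_ik`, the second from the pivots. -/
noncomputable def errL (ρ : Run ε t s Φ Ψ) : Matrix (Fin n) (Fin n) ℝ :=
  Matrix.of fun i k => ‖ρ.Lhat i k‖ + ‖ρ.L i k‖ * ‖ρ.V k k k‖

/-- Common entrywise bound for the moduli of `L` and of its computed counterpart. -/
noncomputable def boundL (ρ : Run ε t s Φ Ψ) : Matrix (Fin n) (Fin n) ℝ :=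
  Matrix.of fun i k => ‖ρ.L i k‖ + 5 * entryConst α * ε * ρ.errL i k

/-- Common entrywise bound for the moduli of `U` and of its computed counterpart. -/
noncomputable def boundU (ρ : Run ε t s Φ Ψ) : Matrix (Fin n) (Fin n) ℝ :=
  Matrix.of fun k j => ‖ρ.U k j‖ + entryConst α * ε * ‖ρ.Uhat k j‖

/-- Entrywise measure of the error of row `k` of `U` divided by its pivot, up to a multiple of
`ε` and scaled by the pivot. -/
noncomputable def errU (ρ : Run ε t s Φ Ψ) : Matrix (Fin n) (Fin n) ℝ :=
  Matrix.of fun k j => ‖ρ.Uhat k j‖ + ‖ρ.V k k k‖ * ρ.boundU k j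

theorem errL_nonneg (ρ : Run ε t s Φ Ψ) (i k : Fin n) : 0 ≤ ρ.errL i k := by
  rw [errL, Matrix.of_apply]; positivity

theorem norm_L_le_boundL (ρ : Run ε t s Φ Ψ) (hε : 0 ≤ ε) (i k : Fin n) :
    ‖ρ.L i k‖ ≤ ρ.boundL i k := by
  have := ten_le_entryConst α
  have := ρ.errL_nonneg i k
  rw [boundL, Matrix.of_apply]
  exact le_add_of_nonneg_right (by positivity)

theorem norm_U_le_boundU (ρ : Run ε t s Φ Ψ) (hε : 0 ≤ ε) (k j : Fin n) :
    ‖ρ.U k j‖ ≤ ρ.boundU k j := by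
  have := ten_le_entryConst α
  rw [boundU, Matrix.of_apply]
  exact le_add_of_nonneg_right (by positivity)

theorem errU_nonneg (ρ : Run ε t s Φ Ψ) (hε : 0 ≤ ε) (k j : Fin n) : 0 ≤ ρ.errU k j := by
  have := (norm_nonneg _).trans (ρ.norm_U_le_boundU hε k j)
  rw [errU, Matrix.of_apply]; positivity

theorem norm_compU_le_boundU {ρ : Run ε t s Φ Ψ} (hε : 0 ≤ ε) (hε' : ε ≤ 1 / 2)
    (hV : ρ.VDefined) (k j : Fin n) : ‖ρ.compU k j‖ ≤ ρ.boundU k j := by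
  have h1 := norm_compU_sub_U_le hε hε' hV k j
  have h2 := norm_le_norm_add_norm_sub' (ρ.compU k j) (ρ.U k j)
  rw [boundU, Matrix.of_apply]
  linarith

theorem norm_compL_sub_L_le {ρ : Run ε t s Φ Ψ} (hε : 0 ≤ ε) (hε' : ε ≤ 1 / 2)
    (hV : ρ.VDefined) (hs : ∀ k : Fin n, entryConst α * ε * ‖ρ.V k k k‖ ≤ 1 / 2) (i k : Fin n) :
    ‖ρ.compL i k - ρ.L i k‖ ≤ 5 * entryConst α * ε * ρ.errL i k := by
  have hK := ten_le_entryConst α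
  have hnn := ρ.errL_nonneg i k
  rcases lt_trichotomy k i with h | rfl | h
  · have hp := reduced_pivot_ne_zero hε hε' hV h
    have hone := one_le_norm_V (ρ := ρ) (k := k) hV fun h0 =>
      ρ.pivot_ne_zero k i h (col_eq_zero_of_V_eq_zero hε hV h0)
    have h1 := norm_div_sub_div_mul_le hp
      (roundedEntry_sub_reduced_le hε hε' hV h.le le_rfl (ρ.col_spec k i h.le))
      (roundedEntry_sub_reduced_le hε hε' hV le_rfl le_rfl (ρ.col_spec k k le_rfl)) (hs k)
    rw [← le_div_iff₀ (norm_pos_iff.2 hp), mul_div_assoc, add_div, mul_div_assoc, mul_div_assoc,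
      ← norm_div, ← L_apply_of_lt ρ h, ← norm_mul] at h1
    have h2 := (ρ.compL_lower k i h).sub_norm_le
    rw [show ρ.V k i k * ρ.L i k = ρ.Lhat i k by simp [Lhat]] at h1
    rw [errL, Matrix.of_apply]
    have h3 := norm_le_norm_add_norm_sub' (ρ.col i k / ρ.col k k) (ρ.L i k)
    have h4 := norm_sub_le_norm_sub_add_norm_sub (ρ.compL i k) (ρ.col i k / ρ.col k k) (ρ.L i k)
    set q := ‖ρ.col i k / ρ.col k k - ρ.L i k‖
    have h5 : ‖ρ.L i k‖ ≤ ‖ρ.L i k‖ * ‖ρ.V k k k‖ :=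
      le_mul_of_one_le_right (norm_nonneg _) hone
    have h6 := norm_nonneg (ρ.Lhat i k)
    have h7 := norm_nonneg (ρ.L i k)
    rw [mul_comm ‖ρ.V k k k‖] at h1
    set X := ‖ρ.L i k‖ * ‖ρ.V k k k‖
    calc _ ≤ ε * (‖ρ.L i k‖ + q) + q := by nlinarith
      _ ≤ ε * (‖ρ.L i k‖ + q) + q + ε * ‖ρ.Lhat i k‖ :=
          le_add_of_nonneg_right (by positivity)
      _ = (1 + ε) * q + ε * (‖ρ.Lhat i k‖ + ‖ρ.L i k‖) := by ring
      _ ≤ 2 * (2 * (entryConst α * ε) * (‖ρ.Lhat i k‖ + X)) +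
          ε * (‖ρ.Lhat i k‖ + X) := by gcongr; linarith
      _ = (4 * entryConst α + 1) * (ε * (‖ρ.Lhat i k‖ + X)) := by ring
      _ ≤ (5 * entryConst α) * (ε * (‖ρ.Lhat i k‖ + X)) := by gcongr; linarith
      _ = _ := by ring
  · rw [ρ.compL_diag, L_apply_self, sub_self, norm_zero]; positivity
  · rw [ρ.compL_upper k i h, L_apply_of_gt ρ h, sub_self, norm_zero]; positivity

theorem norm_compL_le_boundL {ρ : Run ε t s Φ Ψ} (hε : 0 ≤ ε) (hε' : ε ≤ 1 / 2)
    (hV : ρ.VDefined) (hs : ∀ k : Fin n, entryConst α * ε * ‖ρ.V k k k‖ ≤ 1 / 2) (i k : Fin n) :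
    ‖ρ.compL i k‖ ≤ ρ.boundL i k := by
  have h1 := norm_compL_sub_L_le hε hε' hV hs i k
  have h2 := norm_le_norm_add_norm_sub' (ρ.compL i k) (ρ.L i k)
  rw [boundL, Matrix.of_apply]
  linarith

/-! ### One step of the algorithm -/

/-- The deviation of step `k` from an exact elimination step: by how much the Schur complement of
`R_k` differs from the reduced matrix defined by the updated generators. -/
noncomputable def stepError (ρ : Run ε t s Φ Ψ) (k : Fin n) : Matrix (Fin n) (Fin n) ℂ :=
  Matrix.of fun i j => ρ.reduced k i j - ρ.reduced (k + 1) i j - ρ.L i k * ρ.U k j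

/-- Outside the trailing block the elimination step is exact. -/
theorem stepError_eq_zero {ρ : Run ε t s Φ Ψ} (hε : 0 ≤ ε) (hε' : ε ≤ 1 / 2)
    (hV : ρ.VDefined) {k i j : Fin n} (h : i ≤ k ∨ j ≤ k) : ρ.stepError k i j = 0 := by
  rw [stepError, Matrix.of_apply, reduced_eq_zero (k := k + 1) ρ (by omega), sub_zero]
  rcases lt_or_ge i k with hi | hi
  · rw [reduced_eq_zero ρ (by omega), L_apply_of_gt ρ hi]; ring
  rcases lt_or_ge j k with hj | hj
  · rw [reduced_eq_zero ρ (by omega), U_apply_of_gt ρ hj]; ring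
  rcases hi.eq_or_lt with rfl | hi'
  · rw [L_apply_self, U_apply_of_le ρ hj]; ring
  · obtain rfl : j = k := by omega
    rw [L_apply_of_lt ρ hi', U_apply_of_le ρ le_rfl,
      div_mul_cancel₀ _ (reduced_pivot_ne_zero hε hε' hV hi'), sub_self]

/-- The perturbation of a Schur complement formed with the computed `l̃_ik` and
`m̃ = ũ_kj / ũ_kk` splits into terms that contain exact inner products only, so that no
factor `V` enters more than once. -/
theorem norm_stepError_le {ρ : Run ε t s Φ Ψ} (hε : 0 ≤ ε) (hε' : ε ≤ 1 / 2)
    (hts : ∀ i j, t i ≠ s j) (hV : ρ.VDefined)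
    (hs : ∀ k : Fin n, entryConst α * ε * ‖ρ.V k k k‖ ≤ 1 / 2)
    {β : ℝ} (hβ0 : 0 ≤ β) (hβ : ∀ i j i' j', ‖t i - s j‖ ≤ β * ‖t i' - s j'‖) (k i j : Fin n) :
    ‖ρ.stepError k i j‖ ≤ 6 * ε * ‖ρ.Rhat (k + 1) i j‖ +
      21 * entryConst α * ε * β *
        (ρ.errL i k * ρ.boundU k j + ρ.boundL i k * ρ.errU k j) := by
  have hK := ten_le_entryConst α
  have hH := ρ.errL_nonneg i k
  have hG := ρ.errU_nonneg hε k j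
  have hlam := (norm_nonneg _).trans (ρ.norm_L_le_boundL hε i k)
  have hmu := (norm_nonneg _).trans (ρ.norm_U_le_boundU hε k j)
  by_cases hkij : i ≤ k ∨ j ≤ k
  · rw [stepError_eq_zero hε hε' hV hkij, norm_zero]; positivity
  obtain ⟨hi, hj⟩ : k < i ∧ k < j := by simpa using hkij
  have hp := reduced_pivot_ne_zero hε hε' hV hi
  have hp0 := norm_pos_iff.2 hp
  have hcol := ρ.pivot_ne_zero k i hi
  have hD : t (ρ.perm i) - s j ≠ 0 := sub_ne_zero.2 (hts _ _)
  have hD0 := norm_pos_iff.2 hD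
  have hNij := mul_apply_eq_reduced_mul ρ hts (k := k) (i := i) (j := j)
    (by exact_mod_cast hi.le) (by exact_mod_cast hj.le)
  have hNkj := mul_apply_eq_reduced_mul ρ hts (k := k) (i := k) (j := j)
    le_rfl (by exact_mod_cast hj.le)
  have hNik := mul_apply_eq_reduced_mul ρ hts (k := k) (i := i) (j := k)
    (by exact_mod_cast hi.le) le_rfl
  have hNkk := mul_apply_eq_reduced_mul ρ hts (k := k) (i := k) (j := k) le_rfl le_rfl
  have hN' := mul_apply_eq_reduced_mul ρ hts (k := k + 1) (i := i) (j := j)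
    (by exact_mod_cast hi) (by exact_mod_cast hj)
  have hTkj := sum_norm_mul_norm_eq hV (le_refl k) hj.le
  have hTik := sum_norm_mul_norm_eq hV hi.le (le_refl k)
  have hTkk := sum_norm_mul_norm_eq hV (le_refl k) (le_refl k)
  have hT' := sum_norm_mul_norm_eq (k := ⟨k + 1, by omega⟩) (i := i) (j := j) hV
    (Fin.mk_le_of_le_val (by omega)) (Fin.mk_le_of_le_val (by omega))
  rw [← U_apply_of_le ρ hj.le] at hNkj
  have hL : ρ.reduced k i k = ρ.L i k * ρ.reduced k k k := by
    rw [L_apply_of_lt ρ hi, div_mul_cancel₀ _ hp]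
  rw [hL] at hNik
  have hm : ‖ρ.compU k j / ρ.compU k k - ρ.U k j / ρ.reduced k k k‖ * ‖ρ.reduced k k k‖ ≤
      2 * (entryConst α * ε) * ρ.errU k j := by
    have h1 := norm_compU_sub_U_le hε hε' hV k j
    have h2 := norm_compU_sub_U_le hε hε' hV k k
    rw [Uhat, Matrix.of_apply, norm_mul, U_apply_of_le ρ le_rfl] at h2
    refine (norm_div_sub_div_mul_le hp h1 h2 (hs k)).trans ?_
    rw [errU, Matrix.of_apply]
    gcongr
    exact ρ.norm_U_le_boundU hε k j
  have hmk : ‖ρ.compU k j / ρ.compU k k‖ * ‖ρ.reduced k k k‖ ≤ 2 * ρ.boundU k j := by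
    have h2 := norm_compU_sub_U_le hε hε' hV k k
    rw [Uhat, Matrix.of_apply, norm_mul, U_apply_of_le ρ le_rfl] at h2
    have h3 := norm_le_norm_add_norm_sub (ρ.compU k k) (ρ.reduced k k k)
    have h4 : ‖ρ.reduced k k k‖ ≤ 2 * ‖ρ.compU k k‖ := by nlinarith [hs k]
    have h5 : 0 < ‖ρ.compU k k‖ := by linarith
    rw [norm_div, div_mul_eq_mul_div, div_le_iff₀ h5]
    calc _ ≤ ρ.boundU k j * (2 * ‖ρ.compU k k‖) := by
          gcongr
          exact norm_compU_le_boundU hε hε' hV k j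
      _ = _ := by ring
  have hl := norm_compL_sub_L_le hε hε' hV hs i k
  have hl' := norm_compL_le_boundL hε hε' hV hs i k
  have hl0 := ρ.norm_L_le_boundL hε i k
  have hu0 := ρ.norm_U_le_boundU hε k j
  -- rounding errors of the generator update, summed over the inner product
  have hround := fun a => norm_mul_sub_mul_le_of_rounded hε hε' (ρ.genΦ_succ k i hi a)
    (ρ.genΨ_succ k j hj a)
  set l' := ρ.compL i k
  set m' := ρ.compU k j / ρ.compU k k
  have hsum : ∑ a, (ρ.genΦ k i a - ρ.genΦ k k a * l') * (ρ.genΨ k a j - ρ.genΨ k a k * m') =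
      (ρ.genΦ k * ρ.genΨ k) i j - l' * (ρ.genΦ k * ρ.genΨ k) k j -
        m' * (ρ.genΦ k * ρ.genΨ k) i k + l' * m' * (ρ.genΦ k * ρ.genΨ k) k k := by
    simp only [Matrix.mul_apply, Finset.mul_sum, ← Finset.sum_sub_distrib,
      ← Finset.sum_add_distrib]
    exact Finset.sum_congr rfl fun a _ => by ring
  have hR : ‖(ρ.genΦ k * ρ.genΨ k) i j - l' * (ρ.genΦ k * ρ.genΨ k) k j -
        m' * (ρ.genΦ k * ρ.genΨ k) i k + l' * m' * (ρ.genΦ k * ρ.genΨ k) k k -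
        (ρ.genΦ (k + 1) * ρ.genΨ (k + 1)) i j‖ ≤
      6 * ε * (‖ρ.V (k + 1) i j‖ * ‖(ρ.genΦ (k + 1) * ρ.genΨ (k + 1)) i j‖) +
      28 * ε * (‖ρ.V k k j‖ * ‖(ρ.genΦ k * ρ.genΨ k) k j‖ * ‖l'‖ +
        ‖ρ.V k k k‖ * ‖(ρ.genΦ k * ρ.genΨ k) k k‖ * (‖l'‖ * ‖m'‖) +
        ‖ρ.V k i k‖ * ‖(ρ.genΦ k * ρ.genΨ k) i k‖ * ‖m'‖) := by
    rw [← hsum, Matrix.mul_apply (M := ρ.genΦ (k + 1)), ← Finset.sum_sub_distrib]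
    refine (norm_sum_le_of_le _ fun a _ => hround a).trans_eq ?_
    rw [← hTkj, ← hTkk, ← hTik, ← Matrix.mul_apply]
    refine Eq.trans ?_ (congrArg (fun x => 6 * ε * x + _) hT')
    simp only [Finset.mul_sum, Finset.sum_mul, ← Finset.sum_add_distrib]
  rw [hNij, hNkj, hNik, hNkk, hN'] at hR
  have hRhat : ‖ρ.V (k + 1) i j‖ * ‖ρ.reduced (k + 1) i j * (t (ρ.perm i) - s j)‖ =
      ‖ρ.Rhat (k + 1) i j‖ * ‖t (ρ.perm i) - s j‖ := by
    rw [Rhat, Matrix.hadamard_apply, norm_mul, norm_mul]; ring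
  have hUhat : ‖ρ.V k k j‖ * ‖ρ.U k j * (t (ρ.perm k) - s j)‖ ≤
      ‖ρ.Uhat k j‖ * (β * ‖t (ρ.perm i) - s j‖) := by
    rw [Uhat, Matrix.of_apply, norm_mul, norm_mul, ← mul_assoc]
    gcongr
    exact hβ _ _ _ _
  have hLhat : ‖ρ.V k i k‖ * ‖ρ.L i k * ρ.reduced k k k * (t (ρ.perm i) - s k)‖ * ‖m'‖ ≤
      ρ.errL i k * (2 * ρ.boundU k j) * (β * ‖t (ρ.perm i) - s j‖) := by
    have h1 : ‖ρ.V k i k‖ * ‖ρ.L i k‖ ≤ ρ.errL i k := by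
      rw [errL, Matrix.of_apply, Lhat, Matrix.of_apply, norm_mul]
      exact le_add_of_nonneg_right (by positivity)
    calc _ = (‖ρ.V k i k‖ * ‖ρ.L i k‖) * (‖m'‖ * ‖ρ.reduced k k k‖) *
          ‖t (ρ.perm i) - s k‖ := by rw [norm_mul, norm_mul]; ring
      _ ≤ _ := by
          gcongr
          exact hβ _ _ _ _
  have hVkk : ‖ρ.V k k k‖ * ‖ρ.reduced k k k * (t (ρ.perm k) - s k)‖ * (‖l'‖ * ‖m'‖) ≤
      ρ.boundL i k * (2 * (‖ρ.V k k k‖ * ρ.boundU k j)) * (β * ‖t (ρ.perm i) - s j‖) := by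
    calc _ = ‖l'‖ * (‖ρ.V k k k‖ * (‖m'‖ * ‖ρ.reduced k k k‖)) *
          ‖t (ρ.perm k) - s k‖ := by rw [norm_mul]; ring
      _ ≤ ρ.boundL i k * (‖ρ.V k k k‖ * (2 * ρ.boundU k j)) *
          (β * ‖t (ρ.perm i) - s j‖) := by
          gcongr
          exact hβ _ _ _ _
      _ = _ := by ring
  -- effect of the errors of the multipliers
  have h1 : ‖(l' - ρ.L i k) * (ρ.U k j * (t (ρ.perm k) - s j) -
        m' * (ρ.reduced k k k * (t (ρ.perm k) - s k)))‖ ≤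
      (5 * entryConst α * ε * ρ.errL i k) *
        (3 * ρ.boundU k j * (β * ‖t (ρ.perm i) - s j‖)) := by
    rw [norm_mul]
    gcongr
    refine (norm_sub_le _ _).trans ?_
    calc _ = ‖ρ.U k j‖ * ‖t (ρ.perm k) - s j‖ +
          (‖m'‖ * ‖ρ.reduced k k k‖) * ‖t (ρ.perm k) - s k‖ := by simp only [norm_mul]; ring
      _ ≤ ρ.boundU k j * (β * ‖t (ρ.perm i) - s j‖) +
          (2 * ρ.boundU k j) * (β * ‖t (ρ.perm i) - s j‖) := by
          gcongr
          · exact hβ _ _ _ _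
          · exact hβ _ _ _ _
      _ = _ := by ring
  have h2 : ‖(m' - ρ.U k j / ρ.reduced k k k) * (ρ.L i k * ρ.reduced k k k *
        (t (ρ.perm i) - s k) - ρ.L i k * (ρ.reduced k k k * (t (ρ.perm k) - s k)))‖ ≤
      (2 * (entryConst α * ε) * ρ.errU k j) *
        (ρ.boundL i k * (2 * (β * ‖t (ρ.perm i) - s j‖))) := by
    calc _ = (‖m' - ρ.U k j / ρ.reduced k k k‖ * ‖ρ.reduced k k k‖) *
          (‖ρ.L i k‖ * ‖(t (ρ.perm i) - s k) - (t (ρ.perm k) - s k)‖) := by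
          simp only [← norm_mul]; ring_nf
      _ ≤ _ := by
          gcongr
          refine (norm_sub_le _ _).trans ?_
          linarith [hβ (ρ.perm i) k (ρ.perm i) j, hβ (ρ.perm k) k (ρ.perm i) j]
  have hkey : ρ.stepError k i j * (t (ρ.perm i) - s j) =
      (l' - ρ.L i k) * (ρ.U k j * (t (ρ.perm k) - s j) -
        m' * (ρ.reduced k k k * (t (ρ.perm k) - s k))) +
      (m' - ρ.U k j / ρ.reduced k k k) * (ρ.L i k * ρ.reduced k k k *
        (t (ρ.perm i) - s k) - ρ.L i k * (ρ.reduced k k k * (t (ρ.perm k) - s k))) +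
      (ρ.reduced k i j * (t (ρ.perm i) - s j) - l' * (ρ.U k j * (t (ρ.perm k) - s j)) -
        m' * (ρ.L i k * ρ.reduced k k k * (t (ρ.perm i) - s k)) +
        l' * m' * (ρ.reduced k k k * (t (ρ.perm k) - s k)) -
        ρ.reduced (k + 1) i j * (t (ρ.perm i) - s j)) := by
    rw [stepError, Matrix.of_apply]
    field_simp
    ring
  refine le_of_mul_le_mul_right ?_ hD0
  rw [← norm_mul, hkey]
  refine norm_add₃_le.trans ?_
  rw [hRhat] at hR
  have hGdef : ρ.errU k j = ‖ρ.Uhat k j‖ + ‖ρ.V k k k‖ * ρ.boundU k j := by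
    rw [errU, Matrix.of_apply]
  have hw : 0 ≤ ‖ρ.V k k k‖ * ρ.boundU k j := by positivity
  have hUh := norm_nonneg (ρ.Uhat k j)
  have hR' := hR.trans (add_le_add_right (mul_le_mul_of_nonneg_left (add_le_add_three
    (mul_le_mul hUhat hl' (norm_nonneg _) (by positivity)) hVkk hLhat)
    (by positivity : 0 ≤ 28 * ε)) _)
  refine (add_le_add_three h1 h2 hR').trans ?_
  set Z := β * ‖t (ρ.perm i) - s j‖ with hZ
  have hZ0 : 0 ≤ Z := by positivity
  calc _ ≤ (5 * entryConst α * ε * ρ.errL i k) * (3 * ρ.boundU k j * Z) +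
        (2 * (entryConst α * ε) * ρ.errU k j) * (ρ.boundL i k * (2 * Z)) +
        (6 * ε * (‖ρ.Rhat (k + 1) i j‖ * ‖t (ρ.perm i) - s j‖) +
          28 * ε * ((2 * ρ.boundL i k * Z) * ρ.errU k j +
            ρ.errL i k * (2 * ρ.boundU k j) * Z)) := by
        have : ‖ρ.Uhat k j‖ * Z * ρ.boundL i k + ρ.boundL i k *
            (2 * (‖ρ.V k k k‖ * ρ.boundU k j)) * Z ≤ 2 * ρ.boundL i k * Z * ρ.errU k j := by
          rw [hGdef]
          have : 0 ≤ ‖ρ.Uhat k j‖ * Z * ρ.boundL i k := by positivity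
          linarith
        gcongr
    _ = 6 * ε * ‖ρ.Rhat (k + 1) i j‖ * ‖t (ρ.perm i) - s j‖ +
        ((15 * entryConst α + 56) * (ε * Z * (ρ.errL i k * ρ.boundU k j)) +
          (4 * entryConst α + 56) * (ε * Z * (ρ.boundL i k * ρ.errU k j))) := by ring
    _ ≤ 6 * ε * ‖ρ.Rhat (k + 1) i j‖ * ‖t (ρ.perm i) - s j‖ +
        ((21 * entryConst α) * (ε * Z * (ρ.errL i k * ρ.boundU k j)) +
          (21 * entryConst α) * (ε * Z * (ρ.boundL i k * ρ.errU k j))) := by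
        gcongr <;> linarith
    _ = _ := by rw [hZ]; ring

end Run

/-! ### Ratios of the differences `t_i - s_j` -/

theorem norm_sub_le_maxAbs_div_minAbs_mul {n : ℕ} {t s : Fin n → ℂ} (hts : ∀ i j, t i ≠ s j)
    (i j i' j' : Fin n) :
    ‖t i - s j‖ ≤ maxAbs (cauchy t s) / minAbs (cauchy t s) * ‖t i' - s j'‖ := by
  have hpos : ∀ i j, 0 < ‖t i - s j‖ := fun i j => norm_pos_iff.2 (sub_ne_zero.2 (hts i j))
  have : Nonempty (Fin n × Fin n) := ⟨(i, j)⟩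
  have hmax : 1 / ‖t i' - s j'‖ ≤ maxAbs (cauchy t s) := by
    refine le_of_eq_of_le ?_ (le_ciSup (Set.finite_range fun p : Fin n × Fin n =>
      ‖cauchy t s p.1 p.2‖).bddAbove (i', j'))
    simp [cauchy]
  have hmin : minAbs (cauchy t s) ≤ 1 / ‖t i - s j‖ := by
    refine (ciInf_le (Set.finite_range fun p : Fin n × Fin n =>
      ‖cauchy t s p.1 p.2‖).bddBelow (i, j)).trans_eq ?_
    simp [cauchy]
  have hmin0 : 0 < minAbs (cauchy t s) := by
    obtain ⟨p, hp⟩ := exists_eq_ciInf_of_finite (f := fun p : Fin n × Fin n =>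
      ‖cauchy t s p.1 p.2‖)
    rw [minAbs, ← hp]
    simpa [cauchy] using sub_ne_zero.2 (hts p.1 p.2)
  rw [div_mul_eq_mul_div, le_div_iff₀ hmin0]
  calc _ ≤ ‖t i - s j‖ * (1 / ‖t i - s j‖) := by gcongr
    _ = 1 := mul_one_div_cancel (hpos i j).ne'
    _ = 1 / ‖t i' - s j'‖ * ‖t i' - s j'‖ := (one_div_mul_cancel (hpos i' j').ne').symm
    _ ≤ _ := by gcongr

namespace Run

variable {n α : ℕ} {ε : ℝ} {t s : Fin n → ℂ}
  {Φ : Matrix (Fin n) (Fin α) ℂ} {Ψ : Matrix (Fin α) (Fin n) ℂ}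

/-! ### Accumulation over the steps -/

theorem reduced_eq_sum (ρ : Run ε t s Φ Ψ) {k : ℕ} (hk : k ≤ n) (i j : Fin n) :
    ρ.reduced k i j =
      ∑ m : Fin n, if k ≤ m then ρ.stepError m i j + ρ.L i m * ρ.U m j else 0 := by
  have h1 : ∀ m : Fin n, (if k ≤ m then ρ.stepError m i j + ρ.L i m * ρ.U m j else 0) =
      ρ.reduced (max k m) i j - ρ.reduced (max k (m + 1)) i j := by
    intro m
    split_ifs with h
    · rw [max_eq_right h, max_eq_right (by omega), stepError, Matrix.of_apply]; ring
    · rw [max_eq_left (by omega), max_eq_left (by omega), sub_self]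
  rw [Finset.sum_congr rfl fun m _ => h1 m, Fin.sum_univ_eq_sum_range
    (fun m => ρ.reduced (max k m) i j - ρ.reduced (max k (m + 1)) i j), Finset.sum_range_sub',
    max_eq_right hk, Nat.max_zero, ρ.reduced_eq_zero (k := n) (by omega), sub_zero]

/-- The entrywise product bound for all errors of first order that do not come from rounding the
generators relative to themselves. -/
noncomputable def errLU (ρ : Run ε t s Φ Ψ) : Matrix (Fin n) (Fin n) ℝ :=
  ρ.errL * ρ.boundU + ρ.boundL * ρ.errU

theorem errLU_apply (ρ : Run ε t s Φ Ψ) (i j : Fin n) : ρ.errLU i j =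
    ∑ m, (ρ.errL i m * ρ.boundU m j + ρ.boundL i m * ρ.errU m j) := by
  rw [errLU, Matrix.add_apply, Matrix.mul_apply, Matrix.mul_apply, Finset.sum_add_distrib]

/-- The reduced matrices themselves occur on the right-hand side through `Rhat`; the bound is closed
by taking the maximum over the steps. -/
theorem norm_reduced_le {ρ : Run ε t s Φ Ψ} (hε : 0 ≤ ε) (hε' : ε ≤ 1 / 2)
    (hts : ∀ i j, t i ≠ s j) (hV : ρ.VDefined)
    (hs : ∀ k : Fin n, entryConst α * ε * ‖ρ.V k k k‖ ≤ 1 / 2)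
    {β : ℝ} (hβ0 : 0 ≤ β) (hβ : ∀ i j i' j', ‖t i - s j‖ ≤ β * ‖t i' - s j'‖) (k : Fin n) :
    ‖ρ.reduced k‖ ≤ ‖ρ.L‖ * ‖ρ.U‖ + 6 * ε * ∑ m : Fin n, ‖ρ.Rhat (m + 1)‖ +
      21 * entryConst α * ε * β * ‖ρ.errLU‖ := by
  have hK := ten_le_entryConst α
  set c := 21 * entryConst α * ε * β with hc
  have hc0 : 0 ≤ c := by positivity
  have hentry : ∀ i j, ‖ρ.reduced k i j‖ ≤ ‖(ρ.L.map (‖·‖) * ρ.U.map (‖·‖) +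
      (6 * ε) • ∑ m : Fin n, (ρ.Rhat (m + 1)).map (‖·‖) + c • ρ.errLU) i j‖ := by
    intro i j
    refine le_trans ?_ (Real.le_norm_self _)
    rw [reduced_eq_sum ρ k.2.le]
    calc _ ≤ ∑ m : Fin n, (‖ρ.L i m‖ * ‖ρ.U m j‖ + 6 * ε * ‖ρ.Rhat (m + 1) i j‖ +
          c * (ρ.errL i m * ρ.boundU m j + ρ.boundL i m * ρ.errU m j)) := by
          refine norm_sum_le_of_le _ fun m _ => ?_
          have h1 := norm_stepError_le hε hε' hts hV hs hβ0 hβ m i j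
          have h2 : ‖ρ.stepError m i j + ρ.L i m * ρ.U m j‖ ≤
              ‖ρ.stepError m i j‖ + ‖ρ.L i m‖ * ‖ρ.U m j‖ := by
            rw [← norm_mul]; exact norm_add_le _ _
          split_ifs
          · linarith
          · rw [norm_zero]
            have := norm_nonneg (ρ.stepError m i j + ρ.L i m * ρ.U m j)
            linarith
      _ = _ := by
          simp only [Matrix.add_apply, Matrix.smul_apply, Matrix.sum_apply, Matrix.map_apply,
            smul_eq_mul, errLU_apply, Finset.mul_sum, mul_add, Finset.sum_add_distrib,
            Matrix.mul_apply]
  refine (frobenius_norm_le_of_entry_le hentry).trans (norm_add₃_le.trans ?_)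
  rw [frobenius_norm_smul, frobenius_norm_smul, Real.norm_of_nonneg hc0,
    Real.norm_of_nonneg (by positivity : 0 ≤ 6 * ε)]
  gcongr
  · refine (Matrix.frobenius_norm_mul _ _).trans_eq ?_
    rw [frobenius_norm_map_norm, frobenius_norm_map_norm]
  · exact norm_sum_le_of_le _ fun m _ => (frobenius_norm_map_norm _).le

theorem norm_backwardError_le {ρ : Run ε t s Φ Ψ} (hε : 0 ≤ ε) (hε' : ε ≤ 1 / 2)
    (hts : ∀ i j, t i ≠ s j) (hV : ρ.VDefined)
    (hs : ∀ k : Fin n, entryConst α * ε * ‖ρ.V k k k‖ ≤ 1 / 2)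
    {β : ℝ} (hβ1 : 1 ≤ β) (hβ : ∀ i j i' j', ‖t i - s j‖ ≤ β * ‖t i' - s j'‖) :
    ‖ρ.backwardError‖ ≤ 6 * ε * ∑ m : Fin n, ‖ρ.Rhat (m + 1)‖ +
      2 * (21 * entryConst α * ε * β) * ‖ρ.errLU‖ := by
  have hK := ten_le_entryConst α
  have hβ0 : 0 ≤ β := by linarith
  set c := 21 * entryConst α * ε * β with hc
  have hc0 : 0 ≤ c := by positivity
  have hinput : (cauchyType t s Φ Ψ).submatrix ρ.perm id = ρ.reduced 0 := by
    ext i j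
    rw [reduced_apply ρ (Nat.zero_le _) (Nat.zero_le _), ρ.genΦ_zero, ρ.genΨ_zero]
    simp [cauchyType, Matrix.mul_apply]
  have hentry : ∀ i j, ‖ρ.backwardError i j‖ ≤
      ‖((6 * ε) • ∑ m : Fin n, (ρ.Rhat (m + 1)).map (‖·‖) + (2 * c) • ρ.errLU) i j‖ := by
    intro i j
    refine le_trans ?_ (Real.le_norm_self _)
    rw [backwardError, hinput, Matrix.sub_apply, Matrix.mul_apply,
      reduced_eq_sum ρ (Nat.zero_le n), ← Finset.sum_sub_distrib]
    calc _ ≤ ∑ m : Fin n, (6 * ε * ‖ρ.Rhat (m + 1) i j‖ +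
          2 * c * (ρ.errL i m * ρ.boundU m j + ρ.boundL i m * ρ.errU m j)) := by
          refine norm_sum_le_of_le _ fun m _ => ?_
          rw [if_pos (Nat.zero_le _)]
          have h1 := norm_stepError_le hε hε' hts hV hs hβ0 hβ m i j
          have hH := ρ.errL_nonneg i m
          have hG := ρ.errU_nonneg hε m j
          have hlam := (norm_nonneg _).trans (ρ.norm_L_le_boundL hε i m)
          have hmu := (norm_nonneg _).trans (ρ.norm_U_le_boundU hε m j)
          have hUG : ‖ρ.Uhat m j‖ ≤ ρ.errU m j := by
            rw [errU, Matrix.of_apply]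
            exact le_add_of_nonneg_right (by positivity)
          have h2 : ‖ρ.compL i m * ρ.compU m j - ρ.L i m * ρ.U m j‖ ≤
              c * (ρ.errL i m * ρ.boundU m j + ρ.boundL i m * ρ.errU m j) := by
            rw [show ρ.compL i m * ρ.compU m j - ρ.L i m * ρ.U m j =
              (ρ.compL i m - ρ.L i m) * ρ.compU m j +
                ρ.L i m * (ρ.compU m j - ρ.U m j) by ring]
            refine (norm_add_le _ _).trans ?_
            rw [norm_mul, norm_mul]
            calc _ ≤ (5 * entryConst α * ε * ρ.errL i m) * ρ.boundU m j +
                  ρ.boundL i m * (entryConst α * ε * ρ.errU m j) := by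
                  gcongr
                  · exact norm_compL_sub_L_le hε hε' hV hs i m
                  · exact norm_compU_le_boundU hε hε' hV m j
                  · exact ρ.norm_L_le_boundL hε i m
                  · exact (norm_compU_sub_U_le hε hε' hV m j).trans (by gcongr)
              _ = (5 * entryConst α * ε * 1) * (ρ.errL i m * ρ.boundU m j) +
                  (1 * entryConst α * ε * 1) * (ρ.boundL i m * ρ.errU m j) := by ring
              _ ≤ c * (ρ.errL i m * ρ.boundU m j) + c * (ρ.boundL i m * ρ.errU m j) := by
                  rw [hc]
                  gcongr <;> norm_num
              _ = _ := by ring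
          rw [show ρ.compL i m * ρ.compU m j - (ρ.stepError m i j + ρ.L i m * ρ.U m j) =
            (ρ.compL i m * ρ.compU m j - ρ.L i m * ρ.U m j) - ρ.stepError m i j by ring]
          refine (norm_sub_le _ _).trans ?_
          linarith
      _ = _ := by
          simp only [Matrix.add_apply, Matrix.smul_apply, Matrix.sum_apply, Matrix.map_apply,
            smul_eq_mul, errLU_apply, Finset.mul_sum, mul_add, Finset.sum_add_distrib]
  refine (frobenius_norm_le_of_entry_le hentry).trans ((norm_add_le _ _).trans ?_)
  rw [frobenius_norm_smul, frobenius_norm_smul, Real.norm_of_nonneg (by positivity : 0 ≤ 2 * c),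
    Real.norm_of_nonneg (by positivity : 0 ≤ 6 * ε)]
  gcongr
  exact norm_sum_le_of_le _ fun m _ => (frobenius_norm_map_norm _).le

/-! ### Bounds through the growth factors -/

theorem g₂_nonneg (ρ : Run ε t s Φ Ψ) : 0 ≤ ρ.g₂ := Real.iSup_nonneg fun _ => by positivity

theorem norm_Rhat_le (ρ : Run ε t s Φ Ψ) {X : ℝ} (hX : ∀ k : Fin n, ‖ρ.reduced k‖ ≤ X)
    (m : Fin n) : ‖ρ.Rhat (m + 1)‖ ≤ ρ.g₂ * X := by
  have hX0 : 0 ≤ X := (norm_nonneg _).trans (hX m)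
  have h0 : ∀ k, ρ.reduced k = 0 → ‖ρ.Rhat k‖ = 0 := fun k h => by
    rw [Rhat, h, Matrix.hadamard_zero, norm_zero]
  rcases lt_or_ge ((m : ℕ) + 1) n with h | h
  · have h1 := le_ciSup (Set.finite_range fun k : {k : Fin n // 0 < (k : ℕ)} =>
      ‖ρ.Rhat k.1‖ / ‖ρ.reduced k.1‖).bddAbove ⟨⟨m + 1, h⟩, Nat.succ_pos _⟩
    change ‖ρ.Rhat (m + 1)‖ / ‖ρ.reduced (m + 1)‖ ≤ ρ.g₂ at h1
    by_cases hz : ρ.reduced (m + 1) = 0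
    · rw [h0 _ hz]; exact mul_nonneg ρ.g₂_nonneg hX0
    · rw [div_le_iff₀ (norm_pos_iff.2 hz)] at h1
      exact h1.trans (mul_le_mul_of_nonneg_left (hX ⟨m + 1, h⟩) ρ.g₂_nonneg)
  · rw [h0 _ (by ext i j; exact ρ.reduced_eq_zero (by omega))]
    exact mul_nonneg ρ.g₂_nonneg hX0

theorem sum_norm_Rhat_le (ρ : Run ε t s Φ Ψ) {X : ℝ} (hX : ∀ k : Fin n, ‖ρ.reduced k‖ ≤ X) :
    ∑ m : Fin n, ‖ρ.Rhat (m + 1)‖ ≤ n * ρ.g₂ * X := by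
  refine (Finset.sum_le_card_nsmul _ _ _ fun m _ => ρ.norm_Rhat_le hX m).trans_eq ?_
  simp [mul_assoc]

theorem norm_Lhat_le (ρ : Run ε t s Φ Ψ) :
    ‖ρ.Lhat‖ ≤ 2 * ρ.g₁ (1 / 2) (1 / 2) (1 / 2) * ‖ρ.L‖ := by
  by_cases h : ρ.L = 0
  · have : ρ.Lhat = 0 := by ext i k; simp [Lhat, h]
    simp [this, h]
  · rw [← div_le_iff₀ (norm_pos_iff.2 h), g₁]
    have : 0 ≤ ‖ρ.Uhat‖ / ‖ρ.U‖ := by positivity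
    have := norm_nonneg (Matrix.diagonal fun k : Fin n => ρ.V k k k)
    linarith

theorem norm_Uhat_le (ρ : Run ε t s Φ Ψ) :
    ‖ρ.Uhat‖ ≤ 2 * ρ.g₁ (1 / 2) (1 / 2) (1 / 2) * ‖ρ.U‖ := by
  by_cases h : ρ.U = 0
  · have : ρ.Uhat = 0 := by ext i k; simp [Uhat, h]
    simp [this, h]
  · rw [← div_le_iff₀ (norm_pos_iff.2 h), g₁]
    have : 0 ≤ ‖ρ.Lhat‖ / ‖ρ.L‖ := by positivity
    have := norm_nonneg (Matrix.diagonal fun k : Fin n => ρ.V k k k)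
    linarith

theorem norm_diagonal_V_le (ρ : Run ε t s Φ Ψ) :
    ‖(Matrix.diagonal fun k : Fin n => ρ.V k k k : Matrix (Fin n) (Fin n) ℂ)‖ ≤
      2 * ρ.g₁ (1 / 2) (1 / 2) (1 / 2) := by
  have h1 : 0 ≤ ‖ρ.Lhat‖ / ‖ρ.L‖ := div_nonneg (norm_nonneg _) (norm_nonneg _)
  have h2 : 0 ≤ ‖ρ.Uhat‖ / ‖ρ.U‖ := div_nonneg (norm_nonneg _) (norm_nonneg _)
  unfold g₁
  generalize ‖(Matrix.diagonal fun k : Fin n => ρ.V k k k : Matrix (Fin n) (Fin n) ℂ)‖ = d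
  linarith

theorem norm_V_pivot_le (ρ : Run ε t s Φ Ψ) (k : Fin n) :
    ‖ρ.V k k k‖ ≤ 2 * ρ.g₁ (1 / 2) (1 / 2) (1 / 2) := by
  refine le_trans ?_ ρ.norm_diagonal_V_le
  simpa using norm_entry_le_frobenius_norm
    (Matrix.diagonal fun k : Fin n => ρ.V k k k : Matrix (Fin n) (Fin n) ℂ) k k

/-- All the first-order error measures together are of the order `g₁ ‖L‖ ‖U‖`. -/
theorem norm_errLU_le (ρ : Run ε t s Φ Ψ) (hε : 0 ≤ ε) {g : ℝ} (hg0 : 0 ≤ g)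
    (hg : ρ.g₁ (1 / 2) (1 / 2) (1 / 2) = g) (hsmall : 20 * entryConst α * ε * g ≤ 1) :
    ‖ρ.errLU‖ ≤ 20 * g * (‖ρ.L‖ * ‖ρ.U‖) := by
  have hK := ten_le_entryConst α
  have hLh := ρ.norm_Lhat_le
  have hUh := ρ.norm_Uhat_le
  have hd := ρ.norm_diagonal_V_le
  rw [hg] at hLh hUh hd
  have hL0 := norm_nonneg ρ.L
  have hU0 := norm_nonneg ρ.U
  have hκ : 0 ≤ entryConst α * ε := by positivity
  have h1 : ‖ρ.errL‖ ≤ 4 * g * ‖ρ.L‖ := by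
    have : ρ.errL = ρ.Lhat.map (‖·‖) +
        (ρ.L * Matrix.diagonal fun k : Fin n => ρ.V k k k).map (‖·‖) := by
      ext i k; simp [errL]
    rw [this]
    refine (norm_add_le _ _).trans ?_
    rw [frobenius_norm_map_norm, frobenius_norm_map_norm]
    have := (Matrix.frobenius_norm_mul ρ.L (Matrix.diagonal fun k : Fin n => ρ.V k k k)).trans
      (mul_le_mul_of_nonneg_left hd hL0)
    linarith
  have h2 : ‖ρ.boundL‖ ≤ 2 * ‖ρ.L‖ := by
    have : ρ.boundL = ρ.L.map (‖·‖) + (5 * entryConst α * ε) • ρ.errL := by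
      ext i k; simp [boundL]
    rw [this]
    refine (norm_add_le _ _).trans ?_
    rw [frobenius_norm_map_norm, frobenius_norm_smul, Real.norm_of_nonneg (by positivity)]
    calc _ ≤ ‖ρ.L‖ + 5 * entryConst α * ε * (4 * g * ‖ρ.L‖) := by gcongr
      _ = ‖ρ.L‖ + 20 * entryConst α * ε * g * ‖ρ.L‖ := by ring
      _ ≤ ‖ρ.L‖ + 1 * ‖ρ.L‖ := by gcongr
      _ = _ := by ring
  have h3 : ‖ρ.boundU‖ ≤ 2 * ‖ρ.U‖ := by
    have : ρ.boundU = ρ.U.map (‖·‖) + (entryConst α * ε) • ρ.Uhat.map (‖·‖) := by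
      ext i k; simp [boundU]
    rw [this]
    refine (norm_add_le _ _).trans ?_
    rw [frobenius_norm_map_norm, frobenius_norm_smul, Real.norm_of_nonneg hκ,
      frobenius_norm_map_norm]
    have : 0 ≤ entryConst α * ε * g := by positivity
    calc _ ≤ ‖ρ.U‖ + entryConst α * ε * (2 * g * ‖ρ.U‖) := by gcongr
      _ = ‖ρ.U‖ + 2 * (entryConst α * ε * g) * ‖ρ.U‖ := by ring
      _ ≤ ‖ρ.U‖ + 1 * ‖ρ.U‖ := by gcongr; linarith
      _ = _ := by ring
  have h4 : ‖ρ.errU‖ ≤ 6 * g * ‖ρ.U‖ := by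
    have : ρ.errU = ρ.Uhat.map (‖·‖) +
        (Matrix.diagonal fun k : Fin n => ρ.V k k k).map (‖·‖) * ρ.boundU := by
      have hm : (Matrix.diagonal fun k : Fin n => ρ.V k k k).map (‖·‖) =
          Matrix.diagonal fun k : Fin n => ‖ρ.V k k k‖ := Matrix.diagonal_map norm_zero
      ext i k; rw [hm]; simp [errU]
    rw [this]
    refine (norm_add_le _ _).trans ?_
    have h5 := (Matrix.frobenius_norm_mul
      ((Matrix.diagonal fun k : Fin n => ρ.V k k k).map (‖·‖)) ρ.boundU)
    rw [frobenius_norm_map_norm] at h5 ⊢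
    have h6 := h5.trans (mul_le_mul hd h3 (norm_nonneg _) (by positivity))
    linarith
  calc ‖ρ.errLU‖ ≤ ‖ρ.errL‖ * ‖ρ.boundU‖ + ‖ρ.boundL‖ * ‖ρ.errU‖ :=
        (norm_add_le _ _).trans (add_le_add (Matrix.frobenius_norm_mul _ _)
          (Matrix.frobenius_norm_mul _ _))
    _ ≤ (4 * g * ‖ρ.L‖) * (2 * ‖ρ.U‖) + (2 * ‖ρ.L‖) * (6 * g * ‖ρ.U‖) := by gcongr
    _ = _ := by ring

/-- A matrix of order one with vanishing pivot is factorized without error. -/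
theorem backwardError_eq_zero {ρ : Run ε t s Φ Ψ} (hε : 0 ≤ ε) (hV : ρ.VDefined) {k : Fin n}
    (hk : ρ.V k k k = 0) (huniq : ∀ i : Fin n, i = k) (hk0 : (k : ℕ) = 0) :
    ρ.backwardError = 0 := by
  have hU : ∀ i : Fin n, ρ.compU i i = 0 := fun i => by
    rw [huniq i, ρ.compU_diag, col_eq_zero_of_V_eq_zero hε hV hk]
  have h0 : (ρ.genΦ k * ρ.genΨ k) k k = 0 := by
    have h1 := sum_norm_mul_norm_eq hV (le_refl k) (le_refl k)
    rw [hk, norm_zero, zero_mul] at h1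
    rw [Matrix.mul_apply, ← norm_le_zero_iff, ← h1]
    exact (norm_sum_le _ _).trans_eq (by simp)
  rw [hk0, ρ.genΦ_zero, ρ.genΨ_zero] at h0
  ext i j
  rw [huniq i, huniq j, backwardError, Matrix.sub_apply, Matrix.mul_apply,
    Finset.sum_eq_zero fun m _ => by rw [huniq m, hU, mul_zero]]
  have h0' : (Φ * Ψ) (ρ.perm k) k = 0 := by
    simpa [Matrix.mul_apply] using h0
  simp [cauchyType, h0']

end Run

end GKO

theorem mainTheorem1 (α : ℕ) :
    ∃ c₀ c₅ c₆ c₇ c₈ c₉ : ℝ,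
      0 < c₀ ∧ 0 < c₅ ∧ 0 < c₆ ∧ 0 < c₇ ∧ c₇ < 1 ∧ 0 < c₈ ∧ c₈ < 1 ∧ 0 < c₉ ∧ c₉ < 1 ∧
      ∀ (n : ℕ) (ε : ℝ) (t s : Fin n → ℂ)
        (Φ : Matrix (Fin n) (Fin α) ℂ) (Ψ : Matrix (Fin α) (Fin n) ℂ),
        0 ≤ ε → (∀ i j, t i ≠ s j) →
        ∀ ρ : GKO.Run ε t s Φ Ψ, ρ.VDefined →
          ε * (ρ.g₁ c₇ c₈ c₉ + n * ρ.g₂) ≤ c₀ →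
          ‖ρ.backwardError‖ ≤
            ε * (c₅ * (GKO.maxAbs (GKO.cauchy t s) / GKO.minAbs (GKO.cauchy t s)) *
                  ρ.g₁ c₇ c₈ c₉ + c₆ * n * ρ.g₂) * (‖ρ.L‖ * ‖ρ.U‖) := by
  have hK := GKO.ten_le_entryConst α
  -- `c₀` is what keeps the bounds for the computed factors within twice `‖L‖` and `‖U‖`;
  -- `1260 = 21 * 60`, where `21` comes from one step and `60 = 40 + 20` from the products in
  -- `errLU` and their effect on the reduced matrices
  refine ⟨1 / (20 * GKO.entryConst α), 1260 * GKO.entryConst α, 12, 1 / 2, 1 / 2, 1 / 2,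
    by positivity, by positivity, by norm_num, by norm_num, by norm_num, by norm_num,
    by norm_num, by norm_num, by norm_num, ?_⟩
  intro n ε t s Φ Ψ hε hts ρ hV hsmall
  rcases Nat.eq_zero_or_pos n with rfl | hn
  · have h1 : ρ.backwardError = 0 := Subsingleton.elim _ _
    have h2 : ρ.U = 0 := Subsingleton.elim _ _
    simp [h1, h2]
  obtain ⟨k₀, hk₀⟩ : ∃ k : Fin n, (k : ℕ) = 0 := ⟨⟨0, hn⟩, rfl⟩
  have hg2 := ρ.g₂_nonneg
  have hVg := ρ.norm_V_pivot_le
  have hg0 : 0 ≤ ρ.g₁ (1 / 2) (1 / 2) (1 / 2) := by linarith [norm_nonneg (ρ.V k₀ k₀ k₀), hVg k₀]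
  have herr := fun h => ρ.norm_errLU_le hε hg0 rfl h
  set g := ρ.g₁ (1 / 2) (1 / 2) (1 / 2)
  have hβ := GKO.norm_sub_le_maxAbs_div_minAbs_mul hts
  set β := GKO.maxAbs (GKO.cauchy t s) / GKO.minAbs (GKO.cauchy t s)
  have hβ1 : 1 ≤ β := by
    have h := norm_pos_iff.2 (sub_ne_zero.2 (hts k₀ k₀))
    exact le_of_mul_le_mul_right (by simpa using hβ k₀ k₀ k₀ k₀) h
  have hA : 0 ≤ ‖ρ.L‖ * ‖ρ.U‖ := by positivity
  set A := ‖ρ.L‖ * ‖ρ.U‖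
  by_cases hv : ρ.V k₀ k₀ k₀ = 0
  · have huniq : ∀ i : Fin n, i = k₀ := by
      intro i
      by_contra hne
      exact ρ.pivot_ne_zero k₀ i (by omega) (GKO.Run.col_eq_zero_of_V_eq_zero hε hV hv)
    rw [GKO.Run.backwardError_eq_zero hε hV hv huniq hk₀, norm_zero]
    positivity
  rw [le_div_iff₀ (by positivity)] at hsmall
  have hng : 0 ≤ ε * (n * ρ.g₂) := by positivity
  have hεg : 0 ≤ ε * g := by positivity
  have hs1 : 20 * GKO.entryConst α * ε * g ≤ 1 := by nlinarith
  have hs2 : 12 * (ε * (n * ρ.g₂)) ≤ 1 := by nlinarith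
  have hεg' : 20 * (ε * g) ≤ 1 := by nlinarith
  -- a nonzero `V` at a pivot has modulus at least one, so `ε` itself is small
  have hε' : ε ≤ 1 / 2 := by
    have h1 := GKO.Run.one_le_norm_V hV hv
    have h2 : 1 ≤ 2 * g := h1.trans (hVg k₀)
    nlinarith
  have hs : ∀ k : Fin n, GKO.entryConst α * ε * ‖ρ.V k k k‖ ≤ 1 / 2 := by
    intro k
    calc _ ≤ GKO.entryConst α * ε * (2 * g) := by gcongr; exact hVg k
      _ ≤ 1 / 2 := by linarith
  have : Nonempty (Fin n) := ⟨k₀⟩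
  obtain ⟨k₁, hk₁⟩ := Finite.exists_max fun k : Fin n => ‖ρ.reduced k‖
  have hR := GKO.Run.norm_reduced_le hε hε' hts hV hs (by linarith) hβ k₁
  have hE := GKO.Run.norm_backwardError_le hε hε' hts hV hs hβ1 hβ
  have hsum := ρ.sum_norm_Rhat_le hk₁
  have herr' := herr hs1
  have hX0 := norm_nonneg (ρ.reduced k₁)
  set X := ‖ρ.reduced k₁‖
  set c := 21 * GKO.entryConst α * ε * β with hc
  have hc0 : 0 ≤ c := by positivity
  set N := ε * (n * ρ.g₂) with hN
  have hS : 6 * ε * ∑ m : Fin n, ‖ρ.Rhat (m + 1)‖ ≤ 6 * N * X := by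
    calc _ ≤ 6 * ε * (n * ρ.g₂ * X) := by gcongr
      _ = _ := by rw [hN]; ring
  have hP : c * ‖ρ.errLU‖ ≤ 20 * (c * g * A) := by
    calc _ ≤ c * (20 * g * A) := by gcongr
      _ = _ := by ring
  have hcgA : 0 ≤ c * g * A := by positivity
  -- the growth of the reduced matrices is absorbed, since `ε n g₂` is small
  have hX : X ≤ 2 * (A + 20 * (c * g * A)) := by nlinarith
  calc ‖ρ.backwardError‖ ≤ 6 * N * X + 40 * (c * g * A) := by linarith
    _ ≤ 6 * N * (2 * (A + 20 * (c * g * A))) + 40 * (c * g * A) := by gcongr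
    _ = 12 * N * A + (12 * N) * (20 * (c * g * A)) + 40 * (c * g * A) := by ring
    _ ≤ 12 * N * A + 1 * (20 * (c * g * A)) + 40 * (c * g * A) := by gcongr
    _ = ε * (1260 * GKO.entryConst α * β * g + 12 * n * ρ.g₂) * A := by
        rw [hN, hc]; ring
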